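/- Let $\mathcal H^2_0$ be the space of Dirichlet series $f(s)=\sum_{n\ge 2}a_n n^{-s}$ with $\sum_{n\ge2}|a_n|^2<\infty$; such a series converges absolutely and is holomorphic in $\operatorname{Re}s>1/2$. For $f\in\mathcal H^2_0$ and $\operatorname{Re}s>1/2$ put $$\mathbf Hf(s)=\int_{1/2}^{\infty}f(w)\,(\zeta(w+s)-1)\,dw,\qquad \psi(s)=\sum_{n=2}^\infty\frac{1}{\sqrt n\,\log n}\,n^{-s},$$ where $\zeta$ is the Riemann zeta function. Let $0<\lambda<\pi$ and let $$\theta=\frac1\pi\log\left(\frac{\pi}{\lambda}-\sqrt{\left(\frac{\pi}{\lambda}\right)^2-1}\right).$$ Suppose that $c\in\mathbb C$ and that $f\in\mathcal H^2_0$ satisfies $\mathbf Hf(s)-\lambda f(s)=c\,\psi(s)$ for $\operatorname{Re}s>1/2$. Then there exist a complex number $d$ and polynomially bounded sequences $(c_k)_{k\ge1}$, $(d_k)_{k\ge1}$ of complex numbers (that is, $|c_k|,|d_k|\le Ck^N$ for some constants $C,N$ and all $k\ge1$) such that, with an absolutely convergent series, $$f(s)=cd+\sum_{k=1}^\infty (s-1/2)^{2k-1/2}\left(c_k(s-1/2)^{-i\theta}+d_k(s-1/2)^{i\theta}\right),\qquad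 \tfrac12<s<\tfrac32.$$ In particular, $f'\in L^2(1/2,\infty)$. -/

import Mathlib

open Complex MeasureTheory Set

noncomputable section

namespace MultHilbert

/-- The open half-plane `Re s > 1/2`. -/
def halfPlane : Set ℂ := {s : ℂ | 1 / 2 < s.re}

/-- `f` belongs to the Hardy space `ℋ²₀`: on `Re s > 1/2` it is the sum of a Dirichlet series
`∑_{n ≥ 2} aₙ n⁻ˢ` with square-summable coefficients. Only the values of `f` on the half-plane
matter. -/
def MemH20 (f : ℂ → ℂ) : Prop :=
  ∃ a : ℕ → ℂ, a 0 = 0 ∧ a 1 = 0 ∧ Summable (fun n : ℕ => ‖a n‖ ^ 2) ∧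
    ∀ s ∈ halfPlane, LSeriesHasSum a s (f s)

/-- The integral operator `(H f)(s) = ∫_{1/2}^∞ f(w) (ζ(w + s) - 1) dw`. -/
def opH (f : ℂ → ℂ) (s : ℂ) : ℂ :=
  ∫ w in Ioi (1 / 2 : ℝ), f (w : ℂ) * (riemannZeta ((w : ℂ) + s) - 1)

/-- The analytic symbol `ψ(s) = ∑_{n ≥ 2} n⁻ˢ / (√n log n)`. -/
def symbol (s : ℂ) : ℂ :=
  LSeries (fun n : ℕ => if 2 ≤ n then ((1 / (Real.sqrt n * Real.log n) : ℝ) : ℂ) else 0) s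

/-- `θ(lam) = (1/π) log (π/lam - √((π/lam)² - 1))`. -/
def theta (lam : ℝ) : ℝ :=
  1 / Real.pi * Real.log (Real.pi / lam - Real.sqrt ((Real.pi / lam) ^ 2 - 1))

/-- Polynomially bounded sequences indexed by `k ≥ 1`. -/
def PolyBounded (u : ℕ+ → ℂ) : Prop :=
  ∃ (C : ℝ) (N : ℕ), ∀ k : ℕ+, ‖u k‖ ≤ C * (k : ℝ) ^ N

/-- The `k`-th term `x^{2k-1/2} (cₖ x^{-iθ} + dₖ x^{iθ})`. -/
def repTerm (θ x : ℝ) (ck dk : ℕ+ → ℂ) (k : ℕ+) : ℂ :=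
  ((x ^ (2 * (k : ℝ) - 1 / 2) : ℝ) : ℂ) *
    (ck k * (x : ℂ) ^ (-(I * (θ : ℂ))) + dk k * (x : ℂ) ^ (I * (θ : ℂ)))

end MultHilbert

end

/-!
After the translation `x = s - 1/2` the equation reads `λ (G(x) + c) = ∫₀^∞ G(y) K(x + y) dy` with
`G(y) = f(y + 1/2) - c` and `K(u) = ζ(1 + u) - 1`, a kernel with a simple pole at `0` and
exponential decay; the symbol `ψ` becomes `∫₀^∞ K(x + y) dy`. Rotating the half-line of integration
inside the half-plane continues `g(v) = G(exp v)` to the strip `|Im v| < 4π/3`. The rotations in the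
two directions differ by the residue of the kernel, that is,
`g(v + πi) - g(v - πi) = -(2πi/λ) g(v)`.

The characteristic roots of this difference equation are `-i exp(±πθ)`, so that `g` is a sum of two
quasi-periodic functions, each of the form `exp(z v) H(exp(2v))` with `z = -1/2 ∓ iθ` and `H`
entire. Square-summable coefficients force `√x G(x) → 0` as `x → 0`, which makes both `H` vanish at
the origin and leaves the exponents `3/2 ∓ iθ`. Expanding `H` gives the series. It also bounds `f'`
near `1/2`, while at infinity `f'` decays exponentially.
-/

open Filter Topology Asymptotics
open scoped Real

namespace MultHilbert

theorem differentiableOn_update_limUnder_of_tendsto {f : ℂ → ℂ} {s : Set ℂ} {c : ℂ}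
    (hc : s ∈ 𝓝 c) (hd : DifferentiableOn ℂ f (s \ {c}))
    (hf : Tendsto (fun z => (z - c) * f z) (𝓝[≠] c) (𝓝 0)) :
    DifferentiableOn ℂ (Function.update f c (limUnder (𝓝[≠] c) f)) s := by
  refine differentiableOn_update_limUnder_of_isLittleO hc hd ?_
  have hconst : Tendsto (fun z => (z - c) * f c) (𝓝[≠] c) (𝓝 0) := by
    have : Continuous fun z => (z - c) * f c := by fun_prop
    simpa using (this.tendsto c).mono_left nhdsWithin_le_nhds
  have hsub : Tendsto (fun z => (z - c) * (f z - f c)) (𝓝[≠] c) (𝓝 0) := by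
    simpa [mul_sub] using hf.sub hconst
  refine (isLittleO_iff_tendsto' ?_).2 (hsub.congr fun z => by rw [div_inv_eq_mul, mul_comm])
  filter_upwards [self_mem_nhdsWithin] with z hz h0
  exact absurd (inv_eq_zero.1 h0) (sub_ne_zero.2 hz)

theorem aestronglyMeasurable_deriv_param {X : Type*} [MeasurableSpace X] {μ : Measure X}
    {F : ℂ → X → ℂ} {v : ℂ} (hmeas : ∀ᶠ w in 𝓝 v, AEStronglyMeasurable (F w) μ)
    (hdiff : ∀ᵐ a ∂μ, DifferentiableAt ℂ (fun w => F w a) v) :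
    AEStronglyMeasurable (fun a => deriv (fun w => F w a) v) μ := by
  obtain ⟨u, hu⟩ := (𝓝[≠] (0 : ℂ)).exists_seq_tendsto
  have hu0 : Tendsto u atTop (𝓝 0) := hu.mono_right nhdsWithin_le_nhds
  have hlim : Tendsto (fun n => v + u n) atTop (𝓝 v) := by
    simpa using hu0.const_add v
  obtain ⟨N, hN⟩ := eventually_atTop.1 (hlim.eventually hmeas)
  refine aestronglyMeasurable_of_tendsto_ae (u := atTop)
    (f := fun n a => (u (n + N))⁻¹ • (F (v + u (n + N)) a - F v a))
    (fun n => ((hN _ (Nat.le_add_left N n)).sub hmeas.self_of_nhds).const_smul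
      (u (n + N))⁻¹) ?_
  filter_upwards [hdiff] with a ha
  exact ha.hasDerivAt.tendsto_slope_zero.comp (hu.comp (tendsto_add_atTop_nat N))

theorem differentiableAt_integral_of_dominated {X : Type*} [MeasurableSpace X] {μ : Measure X}
    {F : ℂ → X → ℂ} {v : ℂ} {s : Set ℂ} {bound : X → ℝ} (hs : s ∈ 𝓝 v)
    (hmeas : ∀ w ∈ s, AEStronglyMeasurable (F w) μ)
    (hdiff : ∀ᵐ a ∂μ, ∀ w ∈ s, DifferentiableAt ℂ (fun w => F w a) w)
    (hbound : ∀ᵐ a ∂μ, ∀ w ∈ s, ‖F w a‖ ≤ bound a) (hint : Integrable bound μ) :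
    DifferentiableAt ℂ (fun w => ∫ a, F w a ∂μ) v := by
  obtain ⟨ε, hε, hball⟩ := Metric.mem_nhds_iff.1 hs
  have hsub : ∀ w ∈ Metric.ball v (ε / 2), Metric.closedBall w (ε / 4) ⊆ s := fun w hw z hz => by
    refine hball (Metric.mem_ball.2 ((dist_triangle z w v).trans_lt ?_))
    linarith [Metric.mem_closedBall.1 hz, Metric.mem_ball.1 hw]
  have hv : v ∈ s := mem_of_mem_nhds hs
  have hderiv_le : ∀ᵐ a ∂μ, ∀ w ∈ Metric.ball v (ε / 2),
      ‖deriv (fun w => F w a) w‖ ≤ bound a / (ε / 4) := by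
    filter_upwards [hdiff, hbound] with a hda hba w hw
    refine norm_deriv_le_of_forall_mem_sphere_norm_le (by positivity) ?_ fun z hz =>
      hba z (hsub w hw (Metric.sphere_subset_closedBall hz))
    refine DifferentiableOn.diffContOnCl fun z hz => ?_
    rw [closure_ball _ (by positivity)] at hz
    exact (hda z (hsub w hw hz)).differentiableWithinAt
  refine (hasDerivAt_integral_of_dominated_loc_of_deriv_le
    (F' := fun w a => deriv (fun w => F w a) w) (Metric.ball_mem_nhds v (half_pos hε))
    (eventually_of_mem hs hmeas) (hint.mono' (hmeas v hv) (hbound.mono fun a ha => ha v hv))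
    (aestronglyMeasurable_deriv_param (eventually_of_mem hs hmeas) (hdiff.mono fun a ha => ha v hv))
    hderiv_le (hint.div_const _) ?_).2.differentiableAt
  filter_upwards [hdiff] with a ha w hw
  exact (ha w (hball (Metric.ball_subset_ball (by linarith) hw))).hasDerivAt

section CompExp

variable {E : Type*} [NormedAddCommGroup E] [NormedSpace ℝ E]

lemma integral_comp_exp (g : ℝ → E) :
    ∫ s, Real.exp s • g (Real.exp s) = ∫ t in Ioi (0 : ℝ), g t := by
  rw [← Real.range_exp, ← image_univ]
  simpa [abs_of_pos (Real.exp_pos _)] using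
    (integral_image_eq_integral_abs_deriv_smul MeasurableSet.univ
      (fun x _ => (Real.hasDerivAt_exp x).hasDerivWithinAt) Real.exp_injective.injOn g).symm

lemma integrable_comp_exp (g : ℝ → E) :
    Integrable (fun s => Real.exp s • g (Real.exp s)) ↔ IntegrableOn g (Ioi 0) := by
  rw [← Real.range_exp, ← image_univ]
  simpa [abs_of_pos (Real.exp_pos _)] using
    (integrableOn_image_iff_integrableOn_abs_deriv_smul MeasurableSet.univ
      (fun x _ => (Real.hasDerivAt_exp x).hasDerivWithinAt) Real.exp_injective.injOn g).symm

end CompExp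

/-- The closed sector between the rays of arguments `α` and `β`, without its vertex, as the image
of a horizontal strip under `exp`. Arguments are not reduced modulo `2π`. -/
def sector (α β : ℝ) : Set ℂ := exp '' {v | v.im ∈ uIcc α β}

/-- `y Φ(y)` tends to zero at both ends of `S`. For a sector this makes the integrals of `Φ` over
circular arcs vanish in the limit of small and of large radii. -/
structure VanishesAtEnds (S : Set ℂ) (Φ : ℂ → ℂ) : Prop where
  zero : Tendsto (fun y => y * Φ y) (𝓝[S] 0) (𝓝 0)
  infty : Tendsto (fun y => y * Φ y) (Bornology.cobounded ℂ ⊓ 𝓟 S) (𝓝 0)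

/-- The integral of `Φ` along the ray of argument `α`. -/
noncomputable def rayIntegral (Φ : ℂ → ℂ) (α : ℝ) : ℂ :=
  ∫ t in Ioi (0 : ℝ), exp (α * I) * Φ (exp (α * I) * t)

/-- Absolute convergence of the integral of `Φ` along the ray of argument `α`. -/
def RayIntegrable (Φ : ℂ → ℂ) (α : ℝ) : Prop :=
  IntegrableOn (fun t : ℝ => Φ (exp (α * I) * t)) (Ioi 0)

section Sector

variable {Φ Ψ : ℂ → ℂ} {S : Set ℂ} {α β : ℝ}

lemma exp_ofReal_add_mul_I (s γ : ℝ) : exp (s + γ * I) = exp (γ * I) * Real.exp s := by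
  rw [exp_add, mul_comm, ofReal_exp]

lemma norm_ray (α : ℝ) {t : ℝ} (ht : 0 ≤ t) : ‖exp (α * I) * t‖ = t := by
  rw [norm_mul, norm_exp_ofReal_mul_I, one_mul, Complex.norm_of_nonneg ht]

lemma exp_mem_sector {γ : ℝ} (hγ : γ ∈ uIcc α β) (s : ℝ) : exp (s + γ * I) ∈ sector α β :=
  ⟨s + γ * I, by simpa using hγ, rfl⟩

lemma ray_mem_sector {γ : ℝ} (hγ : γ ∈ uIcc α β) {t : ℝ} (ht : 0 < t) :
    exp (γ * I) * t ∈ sector α β := by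
  simpa [exp_ofReal_add_mul_I, Real.exp_log ht] using exp_mem_sector hγ (Real.log t)

lemma VanishesAtEnds.mono {S' : Set ℂ} (h : VanishesAtEnds S Φ) (hS : S' ⊆ S) :
    VanishesAtEnds S' Φ :=
  ⟨h.zero.mono_left (nhdsWithin_mono _ hS),
    h.infty.mono_left (inf_le_inf_left _ (principal_mono.2 hS))⟩

lemma VanishesAtEnds.sub_const_mul (hΦ : VanishesAtEnds S Φ) (hΨ : VanishesAtEnds S Ψ) (r : ℂ) :
    VanishesAtEnds S fun y => Φ y - r * Ψ y := by
  constructor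
  · simpa [mul_sub, mul_left_comm] using hΦ.zero.sub (hΨ.zero.const_mul r)
  · simpa [mul_sub, mul_left_comm] using hΦ.infty.sub (hΨ.infty.const_mul r)

lemma VanishesAtEnds.update (h : VanishesAtEnds S Φ) {x : ℂ} (hx : x ≠ 0) (m : ℂ) :
    VanishesAtEnds S (Function.update Φ x m) := by
  constructor
  · refine h.zero.congr' ?_
    filter_upwards [mem_nhdsWithin_of_mem_nhds (isOpen_ne.mem_nhds hx.symm)] with y hy
    rw [Function.update_of_ne hy]
  · refine h.infty.congr' ?_
    filter_upwards [(Bornology.eventually_ne_cobounded x).filter_mono inf_le_left] with y hy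
    rw [Function.update_of_ne hy]

lemma norm_exp_strip (p : ℝ × ℝ) : ‖exp (p.1 + p.2 * I)‖ = Real.exp p.1 := by
  simp [Complex.norm_exp]

lemma tendsto_exp_strip_atBot :
    Tendsto (fun p : ℝ × ℝ => exp (p.1 + p.2 * I)) (atBot ×ˢ 𝓟 (uIcc α β))
      (𝓝[sector α β] 0) := by
  refine tendsto_nhdsWithin_iff.2 ⟨tendsto_zero_iff_norm_tendsto_zero.2 ?_, ?_⟩
  · simpa only [norm_exp_strip, Function.comp_def] using Real.tendsto_exp_atBot.comp tendsto_fst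
  · exact eventually_prod_principal_iff.2 (.of_forall fun s γ hγ => exp_mem_sector hγ s)

lemma tendsto_exp_strip_atTop :
    Tendsto (fun p : ℝ × ℝ => exp (p.1 + p.2 * I)) (atTop ×ˢ 𝓟 (uIcc α β))
      (Bornology.cobounded ℂ ⊓ 𝓟 (sector α β)) := by
  refine tendsto_inf.2 ⟨tendsto_norm_atTop_iff_cobounded.1 ?_, tendsto_principal.2 ?_⟩
  · simpa only [norm_exp_strip, Function.comp_def] using Real.tendsto_exp_atTop.comp tendsto_fst
  · exact eventually_prod_principal_iff.2 (.of_forall fun s γ hγ => exp_mem_sector hγ s)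

lemma tendsto_integral_of_tendsto_prod_principal {f : ℝ → ℝ → ℂ} {l : Filter ℝ}
    (h : Tendsto (fun p : ℝ × ℝ => f p.1 p.2) (l ×ˢ 𝓟 (uIcc α β)) (𝓝 0)) :
    Tendsto (fun s => ∫ γ in α..β, f s γ) l (𝓝 0) := by
  rw [Metric.tendsto_nhds]
  intro ε hε
  have hδ : 0 < ε / (|β - α| + 1) := by positivity
  filter_upwards [eventually_prod_principal_iff.1 (Metric.tendsto_nhds.1 h _ hδ)] with s hs
  have hle : ‖∫ γ in α..β, f s γ‖ ≤ ε / (|β - α| + 1) * |β - α| :=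
    intervalIntegral.norm_integral_le_of_norm_le_const fun γ hγ => by
      simpa using (hs γ (uIoc_subset_uIcc hγ)).le
  rw [dist_zero_right]
  refine hle.trans_lt ?_
  rw [div_mul_eq_mul_div, div_lt_iff₀ (by positivity)]
  nlinarith

lemma RayIntegrable.tendsto_integral_strip (h : RayIntegrable Φ α) :
    Tendsto (fun R : ℝ => ∫ s in (-R)..R, exp (s + α * I) * Φ (exp (s + α * I))) atTop
      (𝓝 (rayIntegral Φ α)) := by
  have hcongr : (fun s : ℝ => Real.exp s • (exp (α * I) * Φ (exp (α * I) * Real.exp s))) =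
      fun s : ℝ => exp (s + α * I) * Φ (exp (s + α * I)) := by
    funext s
    rw [exp_ofReal_add_mul_I, real_smul]
    ring
  have hint := (integrable_comp_exp fun t : ℝ => exp (α * I) * Φ (exp (α * I) * t)).2
    (h.const_mul _)
  rw [rayIntegral, ← integral_comp_exp, hcongr]
  rw [hcongr] at hint
  exact intervalIntegral_tendsto_integral hint tendsto_neg_atTop_atBot tendsto_id

/-- Cauchy's theorem for the truncated sector, whose boundary arcs contribute nothing in the
limit. The substitution `y = exp v` turns the truncated sector into a rectangle. -/
theorem rayIntegral_eq_of_vanishesAtEnds (hd : ∀ y ∈ sector α β, DifferentiableAt ℂ Φ y)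
    (h : VanishesAtEnds (sector α β) Φ) (hα : RayIntegrable Φ α) (hβ : RayIntegrable Φ β) :
    rayIntegral Φ α = rayIntegral Φ β := by
  set Ω : ℂ → ℂ := fun v => exp v * Φ (exp v)
  have hΩ : ∀ v : ℂ, v.im ∈ uIcc α β → DifferentiableAt ℂ Ω v := fun v hv =>
    differentiable_exp.differentiableAt.mul
      ((hd _ ⟨v, hv, rfl⟩).comp v differentiable_exp.differentiableAt)
  have hrect (R : ℝ) : (∫ s in (-R)..R, Ω (s + α * I)) - (∫ s in (-R)..R, Ω (s + β * I)) +
      I • (∫ γ in α..β, Ω ((R : ℝ) + γ * I)) - I • (∫ γ in α..β, Ω ((-R : ℝ) + γ * I)) = 0 := by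
    simpa using integral_boundary_rect_eq_zero_of_differentiableOn Ω ⟨-R, α⟩ ⟨R, β⟩
      fun v hv => (hΩ v hv.2).differentiableWithinAt
  have hright : Tendsto (fun R : ℝ => ∫ γ in α..β, Ω ((R : ℝ) + γ * I)) atTop (𝓝 0) :=
    tendsto_integral_of_tendsto_prod_principal (h.infty.comp tendsto_exp_strip_atTop)
  have hleft : Tendsto (fun R : ℝ => ∫ γ in α..β, Ω ((-R : ℝ) + γ * I)) atTop (𝓝 0) :=
    (tendsto_integral_of_tendsto_prod_principal (f := fun s γ => Ω (s + γ * I))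
      (h.zero.comp tendsto_exp_strip_atBot)).comp tendsto_neg_atTop_atBot
  have hlim := (((hα.tendsto_integral_strip.sub hβ.tendsto_integral_strip).add
    (hright.const_smul I)).sub (hleft.const_smul I)).congr hrect
  simpa [sub_eq_zero] using tendsto_nhds_unique hlim tendsto_const_nhds

end Sector

section Residue

variable {Φ Ψ : ℂ → ℂ} {α β x : ℝ} {r : ℂ}

lemma ray_im (α t : ℝ) : (exp (α * I) * t).im = t * Real.sin α := by
  rw [im_mul_ofReal, exp_ofReal_mul_I_im, mul_comm]

lemma ray_ne_ofReal (hα : Real.sin α ≠ 0) {t : ℝ} (ht : 0 < t) (x : ℝ) :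
    exp (α * I) * t ≠ x := fun h => by
  have him := congrArg Complex.im h
  rw [ray_im, ofReal_im] at him
  exact mul_ne_zero ht.ne' hα him

lemma RayIntegrable.sub_const_mul (hΦ : RayIntegrable Φ α) (hΨ : RayIntegrable Ψ α) (r : ℂ) :
    RayIntegrable (fun y => Φ y - r * Ψ y) α :=
  Integrable.sub hΦ (hΨ.const_mul r)

lemma rayIntegral_sub_const_mul (hΦ : RayIntegrable Φ α) (hΨ : RayIntegrable Ψ α) (r : ℂ) :
    rayIntegral (fun y => Φ y - r * Ψ y) α = rayIntegral Φ α - r * rayIntegral Ψ α := by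
  rw [rayIntegral, rayIntegral, rayIntegral, ← integral_const_mul,
    ← integral_sub (hΦ.const_mul _) ((hΨ.const_mul _).const_mul _)]
  simp only [mul_sub, mul_left_comm]

lemma RayIntegrable.update (h : RayIntegrable Φ α) (hα : Real.sin α ≠ 0) (x : ℝ) (m : ℂ) :
    RayIntegrable (Function.update Φ x m) α :=
  IntegrableOn.congr_fun h
    (fun _ ht => (Function.update_of_ne (ray_ne_ofReal hα ht x) _ _).symm) measurableSet_Ioi

lemma rayIntegral_update (hα : Real.sin α ≠ 0) (Φ : ℂ → ℂ) (x : ℝ) (m : ℂ) :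
    rayIntegral (Function.update Φ x m) α = rayIntegral Φ α :=
  setIntegral_congr_fun measurableSet_Ioi fun t ht => by
    simp only [Function.update_of_ne (ray_ne_ofReal hα ht x)]

/-- A function with residue `1` at `x`. The second pole makes it decay fast enough for its
integrals along rays to converge. -/
noncomputable def poleModel (x : ℝ) (y : ℂ) : ℂ := (y - x)⁻¹ - (y + x)⁻¹

lemma poleModel_neg (x : ℝ) (y : ℂ) : poleModel x (-y) = poleModel x y := by
  rw [poleModel, poleModel, ← neg_add', inv_neg, neg_add_eq_sub, ← neg_sub y, inv_neg]
  ring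

lemma poleModel_eq_div {y : ℂ} (h₁ : y ≠ x) (h₂ : y ≠ (-x : ℝ)) :
    poleModel x y = 2 * x / (y ^ 2 - x ^ 2) := by
  rw [ofReal_neg, ← sub_ne_zero, sub_neg_eq_add] at h₂
  rw [← sub_ne_zero] at h₁
  rw [poleModel, inv_sub_inv h₁ h₂, sq_sub_sq]
  ring

lemma differentiableAt_poleModel {y : ℂ} (h₁ : y ≠ x) (h₂ : y ≠ (-x : ℝ)) :
    DifferentiableAt ℂ (poleModel x) y := by
  rw [ofReal_neg, ← sub_ne_zero, sub_neg_eq_add] at h₂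
  rw [← sub_ne_zero] at h₁
  unfold poleModel
  fun_prop (disch := assumption)

lemma vanishesAtEnds_poleModel (hx : 0 < x) : VanishesAtEnds univ (poleModel x) := by
  have hx' : (x : ℂ) ≠ 0 := ofReal_ne_zero.2 hx.ne'
  constructor
  · have hd : DifferentiableAt ℂ (poleModel x) 0 :=
      differentiableAt_poleModel hx'.symm (by simpa using hx.ne')
    have hc : ContinuousAt (fun y => y * poleModel x y) 0 := continuousAt_id.mul hd.continuousAt
    simpa only [nhdsWithin_univ, zero_mul] using hc.tendsto
  · have hinv (a : ℂ) : Tendsto (fun y => (y + a)⁻¹) (Bornology.cobounded ℂ) (𝓝 0) :=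
      tendsto_inv₀_cobounded.comp (tendsto_add_const_cobounded a)
    have hlim : Tendsto (fun y : ℂ => x * (y + -x)⁻¹ + x * (y + x)⁻¹) (Bornology.cobounded ℂ)
        (𝓝 0) := by
      simpa using ((hinv (-x)).const_mul (x : ℂ)).add ((hinv x).const_mul (x : ℂ))
    rw [principal_univ, inf_top_eq]
    refine hlim.congr' ?_
    filter_upwards [Bornology.eventually_ne_cobounded (x : ℂ),
      Bornology.eventually_ne_cobounded (-x : ℂ)] with y h₁ h₂
    rw [← sub_ne_zero] at h₁ h₂
    rw [sub_neg_eq_add] at h₂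
    rw [poleModel, ← sub_eq_add_neg]
    field_simp
    ring

lemma abs_sin_mul_le_norm_ray_sq_sub_sq (α t x : ℝ) :
    |Real.sin α| * (t ^ 2 + x ^ 2) ≤ ‖(exp (α * I) * t) ^ 2 - (x : ℂ) ^ 2‖ := by
  have hsq : ‖(exp (α * I) * t) ^ 2 - (x : ℂ) ^ 2‖ ^ 2 =
      (Real.sin α * (t ^ 2 + x ^ 2)) ^ 2 + (Real.cos α * (t ^ 2 - x ^ 2)) ^ 2 := by
    rw [← normSq_eq_norm_sq, normSq_apply, exp_mul_I, ← ofReal_cos, ← ofReal_sin]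
    simp only [sq, sub_re, sub_im, mul_re, mul_im, add_re, add_im, ofReal_re, ofReal_im, I_re, I_im]
    linear_combination
      (t ^ 4 * (Real.cos α ^ 2 + Real.sin α ^ 2) - x ^ 4) * Real.sin_sq_add_cos_sq α
  refine le_of_sq_le_sq ?_ (norm_nonneg _)
  rw [hsq, ← sq_abs (Real.sin α * _), abs_mul, abs_of_nonneg (by positivity : 0 ≤ t ^ 2 + x ^ 2)]
  exact le_add_of_nonneg_right (sq_nonneg _)

lemma integrable_inv_sq_add_sq (hx : x ≠ 0) : Integrable fun t : ℝ => (t ^ 2 + x ^ 2)⁻¹ := by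
  refine ((integrable_inv_one_add_sq.comp_div hx).const_mul (x ^ 2)⁻¹).congr
    (.of_forall fun t => ?_)
  have : t ^ 2 + x ^ 2 ≠ 0 := by positivity
  field_simp
  ring

lemma integral_Ioi_inv_sq_add_sq (hx : 0 < x) :
    ∫ t in Ioi (0 : ℝ), (t ^ 2 + x ^ 2)⁻¹ = π / 2 / x := by
  have hscale := integral_comp_mul_left_Ioi (fun t : ℝ => (1 + t ^ 2)⁻¹) 0 (inv_pos.2 hx)
  rw [mul_zero, integral_Ioi_inv_one_add_sq, Real.arctan_zero, sub_zero, inv_inv,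
    smul_eq_mul] at hscale
  calc ∫ t in Ioi (0 : ℝ), (t ^ 2 + x ^ 2)⁻¹
      = ∫ t in Ioi (0 : ℝ), (x ^ 2)⁻¹ * (1 + (x⁻¹ * t) ^ 2)⁻¹ := by
        refine setIntegral_congr_fun measurableSet_Ioi fun t _ => ?_
        have : t ^ 2 + x ^ 2 ≠ 0 := by positivity
        field_simp
        ring
    _ = π / 2 / x := by
        rw [integral_const_mul, hscale]
        field_simp

lemma rayIntegrable_poleModel (hx : 0 < x) (hα : Real.sin α ≠ 0) :
    RayIntegrable (poleModel x) α := by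
  refine ((integrable_inv_sq_add_sq hx.ne').integrableOn.const_mul (2 * x / |Real.sin α|)).mono'
    (ContinuousOn.aestronglyMeasurable (fun t ht => ?_) measurableSet_Ioi) ?_
  · have hd := differentiableAt_poleModel (ray_ne_ofReal hα ht x) (ray_ne_ofReal hα ht (-x))
    exact (ContinuousAt.comp (f := fun t : ℝ => exp (α * I) * t) hd.continuousAt
      (by fun_prop)).continuousWithinAt
  · filter_upwards [ae_restrict_mem measurableSet_Ioi] with t ht
    rw [poleModel_eq_div (ray_ne_ofReal hα ht x) (ray_ne_ofReal hα ht (-x)), norm_div, norm_mul,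
      Complex.norm_ofNat, Complex.norm_of_nonneg hx.le]
    calc 2 * x / ‖(exp (α * I) * t) ^ 2 - (x : ℂ) ^ 2‖
        ≤ 2 * x / (|Real.sin α| * (t ^ 2 + x ^ 2)) := by
          gcongr
          exact abs_sin_mul_le_norm_ray_sq_sub_sq α t x
      _ = 2 * x / |Real.sin α| * (t ^ 2 + x ^ 2)⁻¹ := by field_simp

lemma rayIntegral_poleModel_pi_div_two (hx : 0 < x) :
    rayIntegral (poleModel x) (π / 2 : ℝ) = -(π * I) := by
  have hI : exp ((π / 2 : ℝ) * I) = I := by push_cast; exact exp_pi_div_two_mul_I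
  have hsin : Real.sin (π / 2) ≠ 0 := by simp
  calc rayIntegral (poleModel x) (π / 2 : ℝ)
      = ∫ t in Ioi (0 : ℝ), -(2 * x * I) * (((t ^ 2 + x ^ 2)⁻¹ : ℝ) : ℂ) := by
        refine setIntegral_congr_fun measurableSet_Ioi fun t ht => ?_
        have hsum : (t : ℂ) ^ 2 + (x : ℂ) ^ 2 ≠ 0 := by
          exact_mod_cast (by positivity : t ^ 2 + x ^ 2 ≠ 0)
        have hsub : (I * t) ^ 2 - (x : ℂ) ^ 2 = -((t : ℂ) ^ 2 + (x : ℂ) ^ 2) := by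
          rw [mul_pow, I_sq]; ring
        rw [poleModel_eq_div (ray_ne_ofReal hsin ht x) (ray_ne_ofReal hsin ht (-x)), hI, hsub]
        push_cast
        field_simp
    _ = -(π * I) := by
        rw [integral_const_mul, integral_complex_ofReal, integral_Ioi_inv_sq_add_sq hx]
        have : (x : ℂ) ≠ 0 := ofReal_ne_zero.2 hx.ne'
        push_cast
        field_simp

lemma rayIntegral_poleModel (hx : 0 < x) (hα : α ∈ Ioo 0 π) :
    rayIntegral (poleModel x) α = -(π * I) := by
  have hpi : π / 2 ∈ Ioo 0 π := ⟨Real.pi_div_two_pos, half_lt_self Real.pi_pos⟩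
  have hsin {γ : ℝ} (hγ : γ ∈ Ioo 0 π) : Real.sin γ ≠ 0 :=
    (Real.sin_pos_of_pos_of_lt_pi hγ.1 hγ.2).ne'
  rw [← rayIntegral_poleModel_pi_div_two hx]
  refine rayIntegral_eq_of_vanishesAtEnds ?_
    ((vanishesAtEnds_poleModel hx).mono (subset_univ _)) (rayIntegrable_poleModel hx (hsin hα))
    (rayIntegrable_poleModel hx (hsin hpi))
  rintro _ ⟨v, hv, rfl⟩
  have hne (a : ℝ) : exp v ≠ a := by
    have := ray_ne_ofReal (hsin (ordConnected_Ioo.uIcc_subset hα hpi hv)) (Real.exp_pos v.re) a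
    rwa [← exp_ofReal_add_mul_I, re_add_im] at this
  exact differentiableAt_poleModel (hne x) (hne (-x))

lemma rayIntegral_poleModel_sub_pi (x α : ℝ) :
    rayIntegral (poleModel x) (α - π) = -rayIntegral (poleModel x) α := by
  have hexp : exp ((α - π : ℝ) * I) = -exp (α * I) := by
    rw [ofReal_sub, sub_mul, exp_sub, exp_pi_mul_I, div_neg, div_one]
  simp only [rayIntegral, hexp, neg_mul, poleModel_neg, integral_neg]

lemma rayIntegral_poleModel_of_neg (hx : 0 < x) (hβ : β ∈ Ioo (-π) 0) :
    rayIntegral (poleModel x) β = π * I := by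
  have := rayIntegral_poleModel hx (α := β + π) ⟨by linarith [hβ.1], by linarith [hβ.2]⟩
  rw [← add_sub_cancel_right β π, rayIntegral_poleModel_sub_pi, this, neg_neg]

lemma tendsto_sub_mul_poleModel (hx : x ≠ 0) :
    Tendsto (fun y : ℂ => (y - x) * poleModel x y) (𝓝[≠] (x : ℂ)) (𝓝 1) := by
  have hx' : (x : ℂ) + x ≠ 0 := by exact_mod_cast (by simpa using hx : x + x ≠ 0)
  have hc : ContinuousAt (fun y : ℂ => 1 - (y - x) * (y + x)⁻¹) x := by
    fun_prop (disch := assumption)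
  have hlim := hc.tendsto.mono_left (nhdsWithin_le_nhds (s := {(x : ℂ)}ᶜ))
  simp only [sub_self, zero_mul, sub_zero] at hlim
  refine hlim.congr' ?_
  filter_upwards [self_mem_nhdsWithin] with y hy
  rw [poleModel, mul_sub, mul_inv_cancel₀ (sub_ne_zero.2 hy)]

lemma ne_ofReal_of_mem_sector (hα : α ∈ Ioo 0 π) (hβ : β ∈ Ioo (-π) 0) (hx : x < 0) {y : ℂ}
    (hy : y ∈ sector β α) : y ≠ x := by
  obtain ⟨v, hv, rfl⟩ := hy
  rw [mem_ofPred_eq, uIcc_of_le (hβ.2.trans hα.1).le] at hv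
  intro h
  have harg := congrArg arg h
  rw [arg_exp, arg_ofReal_of_neg hx, (toIocMod_eq_self _).2
    ⟨by linarith [hβ.1, hv.1], by linarith [hα.2, hv.2]⟩] at harg
  linarith [hα.2, hv.2]

lemma sector_mem_nhds_ofReal (hα : 0 < α) (hβ : β < 0) (hx : 0 < x) :
    sector β α ∈ 𝓝 (x : ℂ) := by
  have hopen : IsOpen (exp '' {v : ℂ | v.im ∈ Ioo β α}) :=
    isOpenMap_exp _ (isOpen_Ioo.preimage continuous_im)
  refine mem_of_superset (hopen.mem_nhds ⟨Real.log x, by simp [hα, hβ], ?_⟩)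
    (image_mono fun v hv => ?_)
  · rw [← ofReal_exp, Real.exp_log hx]
  · exact (Ioo_subset_Icc_self.trans Icc_subset_uIcc) hv

theorem rayIntegral_sub_eq_residue (hx : 0 < x) (hα : α ∈ Ioo 0 π) (hβ : β ∈ Ioo (-π) 0)
    (hd : ∀ y ∈ sector β α, y ≠ x → DifferentiableAt ℂ Φ y) (h : VanishesAtEnds (sector β α) Φ)
    (hΦα : RayIntegrable Φ α) (hΦβ : RayIntegrable Φ β)
    (hr : Tendsto (fun y => (y - x) * Φ y) (𝓝[≠] (x : ℂ)) (𝓝 r)) :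
    rayIntegral Φ α - rayIntegral Φ β = -(2 * π * I * r) := by
  have hsinα : Real.sin α ≠ 0 := (Real.sin_pos_of_pos_of_lt_pi hα.1 hα.2).ne'
  have hsinβ : Real.sin β ≠ 0 := (Real.sin_neg_of_neg_of_neg_pi_lt hβ.2 hβ.1).ne
  set Ψ : ℂ → ℂ := fun y => Φ y - r * poleModel x y
  set Ψ' := Function.update Ψ x (limUnder (𝓝[≠] (x : ℂ)) Ψ)
  have hΨ : ∀ y ∈ sector β α, y ≠ x → DifferentiableAt ℂ Ψ y := fun y hy hyx =>
    (hd y hy hyx).sub ((differentiableAt_poleModel hyx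
      (ne_ofReal_of_mem_sector hα hβ (neg_neg_of_pos hx) hy)).const_mul r)
  have hΨ' : ∀ y ∈ sector β α, DifferentiableAt ℂ Ψ' y := fun y hy => by
    rcases eq_or_ne y x with rfl | hyx
    · refine (differentiableOn_update_limUnder_of_tendsto (sector_mem_nhds_ofReal hα.1 hβ.2 hx)
        (fun z hz => (hΨ z hz.1 hz.2).differentiableWithinAt) ?_).differentiableAt
        (sector_mem_nhds_ofReal hα.1 hβ.2 hx)
      simpa [Ψ, mul_sub, mul_left_comm] using
        hr.sub ((tendsto_sub_mul_poleModel hx.ne').const_mul r)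
    · refine (hΨ y hy hyx).congr_of_eventuallyEq ?_
      filter_upwards [isOpen_ne.mem_nhds hyx] with z hz using Function.update_of_ne hz _ _
  have hends : VanishesAtEnds (sector β α) Ψ' :=
    (h.sub_const_mul ((vanishesAtEnds_poleModel hx).mono (subset_univ _)) r).update
      (ofReal_ne_zero.2 hx.ne') _
  have hpα := rayIntegrable_poleModel hx hsinα
  have hpβ := rayIntegrable_poleModel hx hsinβ
  have hcauchy := rayIntegral_eq_of_vanishesAtEnds hΨ' hends
    ((hΦβ.sub_const_mul hpβ r).update hsinβ x _) ((hΦα.sub_const_mul hpα r).update hsinα x _)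
  rw [rayIntegral_update hsinα, rayIntegral_update hsinβ, rayIntegral_sub_const_mul hΦα hpα,
    rayIntegral_sub_const_mul hΦβ hpβ, rayIntegral_poleModel hx hα,
    rayIntegral_poleModel_of_neg hx hβ] at hcauchy
  linear_combination -hcauchy

end Residue

/-- A kernel with a simple pole of residue `1` at the origin, no other singularity, and exponential
decay to the right. The value at the origin is arbitrary. -/
structure IsPoleKernel (K : ℂ → ℂ) : Prop where
  exists_entire : ∃ E : ℂ → ℂ, Differentiable ℂ E ∧ ∀ u, u ≠ 0 → K u = u⁻¹ + E u
  exists_decay : ∃ B δ : ℝ, 0 < δ ∧ ∀ u : ℂ, 1 ≤ u.re → ‖K u‖ ≤ B * Real.exp (-δ * u.re)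

namespace IsPoleKernel

variable {K : ℂ → ℂ}

lemma differentiableAt (hK : IsPoleKernel K) {u : ℂ} (hu : u ≠ 0) : DifferentiableAt ℂ K u := by
  obtain ⟨E, hE, hKE⟩ := hK.exists_entire
  refine ((differentiableAt_inv hu).add (hE u)).congr_of_eventuallyEq ?_
  filter_upwards [isOpen_ne.mem_nhds hu] with z hz using hKE z hz

lemma tendsto_mul (hK : IsPoleKernel K) : Tendsto (fun u => u * K u) (𝓝[≠] 0) (𝓝 1) := by
  obtain ⟨E, hE, hKE⟩ := hK.exists_entire
  have hc : Continuous fun u => 1 + u * E u := by have := hE.continuous; fun_prop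
  have hlim := (hc.tendsto 0).mono_left (nhdsWithin_le_nhds (s := {(0 : ℂ)}ᶜ))
  simp only [zero_mul, add_zero] at hlim
  refine hlim.congr' ?_
  filter_upwards [self_mem_nhdsWithin] with u hu
  rw [hKE u hu, mul_add, mul_inv_cancel₀ hu]

lemma exists_norm_le_div (hK : IsPoleKernel K) (R : ℝ) :
    ∃ B, ∀ u : ℂ, u ≠ 0 → ‖u‖ ≤ R → ‖K u‖ ≤ B / ‖u‖ := by
  obtain ⟨E, hE, hKE⟩ := hK.exists_entire
  have hc : Continuous fun u => 1 + u * E u := by have := hE.continuous; fun_prop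
  obtain ⟨B, hB⟩ := (isCompact_closedBall (0 : ℂ) R).exists_bound_of_continuousOn hc.continuousOn
  refine ⟨B, fun u hu huR => ?_⟩
  rw [le_div_iff₀ (norm_pos_iff.2 hu), mul_comm, ← norm_mul, hKE u hu, mul_add, mul_inv_cancel₀ hu]
  exact hB u (mem_closedBall_zero_iff.2 huR)

end IsPoleKernel

lemma sin_mul_exp_le_norm_exp_add_ray {v : ℂ} {α γ t : ℝ} (hγ : |v.im - α| ≤ γ) (hγπ : γ ≤ π)
    (ht : 0 ≤ t) : Real.sin γ * Real.exp v.re ≤ ‖exp v + exp (α * I) * t‖ := by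
  have hcos : Real.cos γ ≤ Real.cos (v.im - α) := by
    rw [← Real.cos_abs (v.im - α)]
    exact Real.cos_le_cos_of_nonneg_of_le_pi (abs_nonneg _) hγπ hγ
  have hsq : ‖exp v + exp (α * I) * t‖ ^ 2 =
      Real.exp v.re ^ 2 + t ^ 2 + 2 * (Real.exp v.re * t) * Real.cos (v.im - α) := by
    rw [← normSq_eq_norm_sq, normSq_apply, add_re, add_im, re_mul_ofReal, im_mul_ofReal,
      exp_ofReal_mul_I_re, exp_ofReal_mul_I_im, exp_re, exp_im, Real.cos_sub]
    linear_combination Real.exp v.re ^ 2 * Real.sin_sq_add_cos_sq v.im +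
      t ^ 2 * Real.sin_sq_add_cos_sq α
  refine le_of_sq_le_sq ?_ (norm_nonneg _)
  calc (Real.sin γ * Real.exp v.re) ^ 2
      = Real.exp v.re ^ 2 + t ^ 2 + 2 * (Real.exp v.re * t) * Real.cos γ -
          (t + Real.exp v.re * Real.cos γ) ^ 2 := by
        linear_combination Real.exp v.re ^ 2 * Real.sin_sq_add_cos_sq γ
    _ ≤ Real.exp v.re ^ 2 + t ^ 2 + 2 * (Real.exp v.re * t) * Real.cos γ :=
        sub_le_self _ (sq_nonneg _)
    _ ≤ ‖exp v + exp (α * I) * t‖ ^ 2 := by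
        rw [hsq]
        gcongr

lemma exp_add_ray_ne_zero {v : ℂ} {α t : ℝ} (hv : |v.im - α| < π) (ht : 0 ≤ t) :
    exp v + exp (α * I) * t ≠ 0 := by
  obtain ⟨γ, hγ, hγπ⟩ := exists_between hv
  have hsin := Real.sin_pos_of_pos_of_lt_pi ((abs_nonneg _).trans_lt hγ) hγπ
  exact norm_pos_iff.1 ((mul_pos hsin (Real.exp_pos _)).trans_le
    (sin_mul_exp_le_norm_exp_add_ray hγ.le hγπ.le ht))

namespace IsPoleKernel

variable {K : ℂ → ℂ} {α γ : ℝ}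

lemma exists_norm_ray_le_of_ge (hK : IsPoleKernel K) (hα : |α| < π / 2) (L : ℝ) :
    ∃ B δ : ℝ, 0 ≤ B ∧ 0 < δ ∧ ∀ v : ℂ, v.re ≤ L → ∀ t : ℝ, (1 + Real.exp L) / Real.cos α ≤ t →
      ‖K (exp v + exp (α * I) * t)‖ ≤ B * Real.exp (-δ * t) := by
  obtain ⟨B, δ, hδ, hfar⟩ := hK.exists_decay
  have hcos : 0 < Real.cos α := Real.cos_pos_of_mem_Ioo (abs_lt.1 hα)
  refine ⟨|B| * Real.exp (δ * Real.exp L), δ * Real.cos α, by positivity, mul_pos hδ hcos,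
    fun v hvL t ht => ?_⟩
  have hre : Real.cos α * t - Real.exp L ≤ (exp v + exp (α * I) * t).re := by
    rw [add_re, re_mul_ofReal, exp_ofReal_mul_I_re]
    have := (abs_le.1 ((abs_re_le_norm (exp v)).trans_eq (norm_exp v))).1
    linarith [Real.exp_le_exp.2 hvL]
  have hone : 1 + Real.exp L ≤ Real.cos α * t := (div_le_iff₀' hcos).1 ht
  calc ‖K (exp v + exp (α * I) * t)‖
      ≤ |B| * Real.exp (-δ * (Real.cos α * t - Real.exp L)) := by
        refine (hfar _ (by linarith)).trans ?_
        gcongr ?_ * Real.exp ?_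
        · exact le_abs_self _
        · exact mul_le_mul_of_nonpos_left hre (neg_nonpos.2 hδ.le)
    _ = |B| * Real.exp (δ * Real.exp L) * Real.exp (-(δ * Real.cos α) * t) := by
        rw [mul_assoc, ← Real.exp_add]
        ring_nf

lemma exists_norm_ray_le_of_le (hK : IsPoleKernel K) (hγ : γ ∈ Ioo 0 π) (L T : ℝ) :
    ∃ B : ℝ, 0 ≤ B ∧ ∀ v : ℂ, |v.im - α| ≤ γ → v.re ≤ L → ∀ t ∈ Icc 0 T,
      ‖K (exp v + exp (α * I) * t)‖ ≤ B * Real.exp (-v.re) := by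
  have hsin := Real.sin_pos_of_pos_of_lt_pi hγ.1 hγ.2
  obtain ⟨B, hnear⟩ := hK.exists_norm_le_div (Real.exp L + T)
  refine ⟨|B| / Real.sin γ, by positivity, fun v hv hvL t ht => ?_⟩
  have hR : ‖exp v + exp (α * I) * t‖ ≤ Real.exp L + T := by
    refine (norm_add_le _ _).trans ?_
    rw [norm_ray _ ht.1, norm_exp]
    exact add_le_add (Real.exp_le_exp.2 hvL) ht.2
  calc ‖K (exp v + exp (α * I) * t)‖
      ≤ |B| / (Real.sin γ * Real.exp v.re) := by
        refine (hnear _ (exp_add_ray_ne_zero (hv.trans_lt hγ.2) ht.1) hR).trans ?_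
        gcongr
        · exact le_abs_self _
        · exact sin_mul_exp_le_norm_exp_add_ray hv hγ.2.le ht.1
    _ = |B| / Real.sin γ * Real.exp (-v.re) := by
        rw [Real.exp_neg, div_mul_eq_div_div, div_eq_mul_inv]

theorem exists_norm_ray_le (hK : IsPoleKernel K) (hα : |α| < π / 2) (hγ : γ ∈ Ioo 0 π) (L : ℝ) :
    ∃ B δ : ℝ, 0 < δ ∧ ∀ v : ℂ, |v.im - α| ≤ γ → v.re ≤ L → ∀ t : ℝ, 0 ≤ t →
      ‖K (exp v + exp (α * I) * t)‖ ≤ B * Real.exp (-δ * t) * Real.exp (-v.re) := by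
  set T := (1 + Real.exp L) / Real.cos α
  obtain ⟨B₁, δ, hB₁, hδ, hfar⟩ := hK.exists_norm_ray_le_of_ge hα L
  obtain ⟨B₂, hB₂, hnear⟩ := hK.exists_norm_ray_le_of_le (α := α) hγ L T
  refine ⟨B₁ * Real.exp L + B₂ * Real.exp (δ * T), δ, hδ, fun v hv hvL t ht => ?_⟩
  rcases le_total T t with htT | htT
  · have hone : 1 ≤ Real.exp L * Real.exp (-v.re) := by
      rw [← Real.exp_add]
      exact Real.one_le_exp (by linarith)
    calc ‖K (exp v + exp (α * I) * t)‖
        ≤ B₁ * Real.exp (-δ * t) * (Real.exp L * Real.exp (-v.re)) :=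
          (hfar v hvL t htT).trans (le_mul_of_one_le_right (by positivity) hone)
      _ = B₁ * Real.exp L * Real.exp (-δ * t) * Real.exp (-v.re) := by ring
      _ ≤ (B₁ * Real.exp L + B₂ * Real.exp (δ * T)) * Real.exp (-δ * t) * Real.exp (-v.re) := by
          gcongr
          exact le_add_of_nonneg_right (by positivity)
  · have hone : 1 ≤ Real.exp (δ * T) * Real.exp (-δ * t) := by
      rw [← Real.exp_add]
      exact Real.one_le_exp (by nlinarith)
    calc ‖K (exp v + exp (α * I) * t)‖
        ≤ B₂ * (Real.exp (δ * T) * Real.exp (-δ * t)) * Real.exp (-v.re) := by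
          refine (hnear v hv hvL t ⟨ht, htT⟩).trans ?_
          gcongr
          exact le_mul_of_one_le_right hB₂ hone
      _ = B₂ * Real.exp (δ * T) * Real.exp (-δ * t) * Real.exp (-v.re) := by ring
      _ ≤ (B₁ * Real.exp L + B₂ * Real.exp (δ * T)) * Real.exp (-δ * t) * Real.exp (-v.re) := by
          gcongr
          exact le_add_of_nonneg_left (by positivity)

end IsPoleKernel

lemma eq_on_strip_of_eq_ofReal {f g : ℂ → ℂ} {ε : ℝ} (hε : 0 < ε)
    (hf : ∀ v : ℂ, |v.im| < ε → DifferentiableAt ℂ f v)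
    (hg : ∀ v : ℂ, |v.im| < ε → DifferentiableAt ℂ g v) (h : ∀ s : ℝ, f s = g s) {v : ℂ}
    (hv : |v.im| < ε) : f v = g v := by
  have hset : {v : ℂ | |v.im| < ε} = im ⁻¹' Ioo (-ε) ε := ext fun v => by simp [abs_lt]
  have hopen : IsOpen {v : ℂ | |v.im| < ε} := isOpen_lt (by fun_prop) continuous_const
  have hconv : Convex ℝ {v : ℂ | |v.im| < ε} := hset ▸ (convex_Ioo _ _).linear_preimage imLm
  have hanalytic {f : ℂ → ℂ} (hf : ∀ v : ℂ, |v.im| < ε → DifferentiableAt ℂ f v) :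
      AnalyticOnNhd ℂ f {v : ℂ | |v.im| < ε} :=
    DifferentiableOn.analyticOnNhd (fun v hv => (hf v hv).differentiableWithinAt) hopen
  refine (hanalytic hf).eqOn_of_preconnected_of_frequently_eq (hanalytic hg) hconv.isPreconnected
    (z₀ := 0) (by simpa) ?_ hv
  have hreal : Tendsto (fun s : ℝ => (s : ℂ)) (𝓝[≠] 0) (𝓝[≠] 0) := by
    refine tendsto_nhdsWithin_iff.2 ⟨?_, ?_⟩
    · exact (by simpa using continuous_ofReal.tendsto 0 :
        Tendsto (fun s : ℝ => (s : ℂ)) (𝓝 0) (𝓝 0)).mono_left nhdsWithin_le_nhds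
    · filter_upwards [self_mem_nhdsWithin] with s hs using ofReal_ne_zero.2 hs
  exact hreal.frequently (Frequently.of_forall h)

lemma exists_mul_norm_le_re {α β : ℝ} (hα : |α| < π / 2) (hβ : |β| < π / 2) :
    ∃ κ, 0 < κ ∧ ∀ y ∈ sector α β, κ * ‖y‖ ≤ y.re := by
  refine ⟨Real.cos (max |α| |β|), Real.cos_pos_of_mem_Ioo ⟨?_, max_lt hα hβ⟩, ?_⟩
  · exact (neg_neg_of_pos Real.pi_div_two_pos).trans_le (le_max_of_le_left (abs_nonneg α))
  rintro _ ⟨v, hv, rfl⟩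
  have hle : |v.im| ≤ max |α| |β| := by
    rcases mem_uIcc.1 hv with h | h
    · exact abs_le_max_abs_abs h.1 h.2
    · exact (abs_le_max_abs_abs h.1 h.2).trans_eq (max_comm _ _)
  have hcos : Real.cos (max |α| |β|) ≤ Real.cos v.im := by
    rw [← Real.cos_abs v.im]
    exact Real.cos_le_cos_of_nonneg_of_le_pi (abs_nonneg _)
      ((max_lt hα hβ).le.trans (half_le_self Real.pi_pos.le)) hle
  rw [norm_exp, exp_re, mul_comm]
  gcongr

lemma ray_re_pos {α : ℝ} (hα : |α| < π / 2) {t : ℝ} (ht : 0 < t) : 0 < (exp (α * I) * t).re := by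
  rw [re_mul_ofReal, exp_ofReal_mul_I_re]
  exact mul_pos (Real.cos_pos_of_mem_Ioo (abs_lt.1 hα)) ht

/-- The regularity of `y ↦ f(y + 1/2) - c` for `f` in `ℋ²₀`: analytic in the right half-plane, and
growing at most like the inverse square root of the distance to its boundary. -/
structure IsHardyLike (G : ℂ → ℂ) : Prop where
  differentiableAt : ∀ y : ℂ, 0 < y.re → DifferentiableAt ℂ G y
  exists_norm_le : ∃ M : ℝ, ∀ y : ℂ, 0 < y.re → ‖G y‖ ≤ M * (1 + y.re ^ (-(1 / 2) : ℝ))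

namespace IsHardyLike

variable {K G : ℂ → ℂ} {α β γ : ℝ}

lemma exists_norm_sector_le (hG : IsHardyLike G) (hα : |α| < π / 2) (hβ : |β| < π / 2) :
    ∃ M, 0 ≤ M ∧ ∀ y ∈ sector α β, 0 < y.re ∧ ‖G y‖ ≤ M * (1 + ‖y‖ ^ (-(1 / 2) : ℝ)) := by
  obtain ⟨κ, hκ, hre⟩ := exists_mul_norm_le_re hα hβ
  obtain ⟨M, hM⟩ := hG.exists_norm_le
  refine ⟨|M| * max 1 (κ ^ (-(1 / 2) : ℝ)), by positivity, fun y hy => ?_⟩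
  have hy0 : 0 < ‖y‖ := norm_pos_iff.2 (by obtain ⟨v, -, rfl⟩ := hy; exact exp_ne_zero v)
  have hpos : 0 < y.re := (mul_pos hκ hy0).trans_le (hre y hy)
  refine ⟨hpos, (hM y hpos).trans ?_⟩
  have hrpow : y.re ^ (-(1 / 2) : ℝ) ≤ κ ^ (-(1 / 2) : ℝ) * ‖y‖ ^ (-(1 / 2) : ℝ) := by
    rw [← Real.mul_rpow hκ.le hy0.le]
    exact Real.rpow_le_rpow_of_nonpos (by positivity) (hre y hy) (by norm_num)
  calc M * (1 + y.re ^ (-(1 / 2) : ℝ))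
      ≤ |M| * (1 + κ ^ (-(1 / 2) : ℝ) * ‖y‖ ^ (-(1 / 2) : ℝ)) := by
        gcongr ?_ * (1 + ?_)
        exact le_abs_self M
    _ ≤ |M| * (max 1 (κ ^ (-(1 / 2) : ℝ)) * 1 +
          max 1 (κ ^ (-(1 / 2) : ℝ)) * ‖y‖ ^ (-(1 / 2) : ℝ)) := by
        gcongr
        · rw [mul_one]
          exact le_max_left _ _
        · exact le_max_right _ _
    _ = |M| * max 1 (κ ^ (-(1 / 2) : ℝ)) * (1 + ‖y‖ ^ (-(1 / 2) : ℝ)) := by ring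

/-- Rotating the path of integration into the half-plane keeps the integrand of the operator under
control as long as the singularity at `y = -exp v` stays off the path. -/
theorem exists_integrable_bound (hK : IsPoleKernel K) (hG : IsHardyLike G) (hα : |α| < π / 2)
    (hγ : γ ∈ Ioo 0 π) (L : ℝ) :
    ∃ b : ℝ → ℝ, IntegrableOn b (Ioi 0) ∧ ∀ v : ℂ, |v.im - α| ≤ γ → v.re ≤ L → ∀ t : ℝ, 0 < t →
      ‖G (exp (α * I) * t) * K (exp v + exp (α * I) * t)‖ ≤ b t * Real.exp (-v.re) := by
  obtain ⟨M, hM0, hM⟩ := hG.exists_norm_sector_le hα hα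
  obtain ⟨B, δ, hδ, hB⟩ := hK.exists_norm_ray_le hα hγ L
  refine ⟨fun t => M * B * (Real.exp (-δ * t) + t ^ (-(1 / 2) : ℝ) * Real.exp (-δ * t)), ?_,
    fun v hv hvL t ht => ?_⟩
  · have hint := integrableOn_rpow_mul_exp_neg_mul_rpow (s := -(1 / 2)) (p := 1) (by norm_num)
      one_pos hδ
    simp only [Real.rpow_one] at hint
    exact ((integrableOn_exp_mul_Ioi (neg_neg_of_pos hδ) 0).add hint).const_mul _
  · have hGle := (hM _ (ray_mem_sector left_mem_uIcc ht)).2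
    rw [norm_ray α ht.le] at hGle
    calc ‖G (exp (α * I) * t) * K (exp v + exp (α * I) * t)‖
        ≤ M * (1 + t ^ (-(1 / 2) : ℝ)) * (B * Real.exp (-δ * t) * Real.exp (-v.re)) := by
          rw [norm_mul]
          exact mul_le_mul hGle (hB v hv hvL t ht.le) (norm_nonneg _) (by positivity)
      _ = M * B * (Real.exp (-δ * t) + t ^ (-(1 / 2) : ℝ) * Real.exp (-δ * t)) *
          Real.exp (-v.re) := by ring

lemma aestronglyMeasurable_ray (hK : IsPoleKernel K) (hG : IsHardyLike G) (hα : |α| < π / 2)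
    {v : ℂ} (hv : |v.im - α| < π) :
    AEStronglyMeasurable (fun t : ℝ => G (exp (α * I) * t) * K (exp v + exp (α * I) * t))
      (volume.restrict (Ioi 0)) := by
  refine ContinuousOn.aestronglyMeasurable (fun t ht => ContinuousAt.continuousWithinAt ?_)
    measurableSet_Ioi
  have hGt := (hG.differentiableAt _ (ray_re_pos hα ht)).continuousAt
  have hKt := (hK.differentiableAt (exp_add_ray_ne_zero hv (le_of_lt ht))).continuousAt
  exact (hGt.comp (f := fun t : ℝ => exp (α * I) * t) (by fun_prop)).mul
    (hKt.comp (f := fun t : ℝ => exp v + exp (α * I) * t) (by fun_prop))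

lemma rayIntegrable_mul (hK : IsPoleKernel K) (hG : IsHardyLike G) (hα : |α| < π / 2) {v : ℂ}
    (hv : |v.im - α| < π) : RayIntegrable (fun y => G y * K (exp v + y)) α := by
  obtain ⟨γ, hγ, hγπ⟩ := exists_between hv
  obtain ⟨b, hb, hle⟩ := exists_integrable_bound hK hG hα
    ⟨(abs_nonneg _).trans_lt hγ, hγπ⟩ v.re
  refine (hb.mul_const (Real.exp (-v.re))).mono' (aestronglyMeasurable_ray hK hG hα hv) ?_
  filter_upwards [ae_restrict_mem measurableSet_Ioi] with t ht using hle v hγ.le le_rfl t ht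

lemma exists_norm_mul_sector_le (hG : IsHardyLike G) (hα : |α| < π / 2) (hβ : |β| < π / 2) :
    ∃ M, 0 ≤ M ∧ ∀ y ∈ sector α β, ‖y * G y‖ ≤ M * (‖y‖ + ‖y‖ ^ (1 / 2 : ℝ)) := by
  obtain ⟨M, hM0, hM⟩ := hG.exists_norm_sector_le hα hβ
  refine ⟨M, hM0, fun y hy => ?_⟩
  calc ‖y * G y‖ ≤ ‖y‖ * (M * (1 + ‖y‖ ^ (-(1 / 2) : ℝ))) := by
        rw [norm_mul]
        exact mul_le_mul_of_nonneg_left (hM y hy).2 (norm_nonneg y)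
    _ = M * (‖y‖ + ‖y‖ ^ (1 / 2 : ℝ)) := by
        rw [mul_left_comm, mul_add, mul_one, ← Real.rpow_one_add' (norm_nonneg y) (by norm_num)]
        norm_num

lemma tendsto_mul_zero (hK : IsPoleKernel K) (hG : IsHardyLike G) (hα : |α| < π / 2)
    (hβ : |β| < π / 2) {x : ℂ} (hx : x ≠ 0) :
    Tendsto (fun y => y * (G y * K (x + y))) (𝓝[sector α β] 0) (𝓝 0) := by
  obtain ⟨M, -, hM⟩ := hG.exists_norm_mul_sector_le hα hβ
  have hyG : Tendsto (fun y => y * G y) (𝓝[sector α β] 0) (𝓝 0) := by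
    have hc : Continuous fun y : ℂ => M * (‖y‖ + ‖y‖ ^ (1 / 2 : ℝ)) :=
      (continuous_norm.add (continuous_norm.rpow_const fun _ => Or.inr (by norm_num))).const_mul M
    refine squeeze_zero_norm' (eventually_mem_nhdsWithin.mono hM) ?_
    simpa using (hc.tendsto 0).mono_left nhdsWithin_le_nhds
  have hKx : Tendsto (fun y => K (x + y)) (𝓝[sector α β] 0) (𝓝 (K x)) := by
    have hc : ContinuousAt (fun y => K (x + y)) 0 :=
      ContinuousAt.comp (by simpa using (hK.differentiableAt hx).continuousAt) (by fun_prop)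
    simpa using hc.tendsto.mono_left nhdsWithin_le_nhds
  simpa [mul_assoc] using hyG.mul hKx

lemma tendsto_mul_infty (hK : IsPoleKernel K) (hG : IsHardyLike G) (hα : |α| < π / 2)
    (hβ : |β| < π / 2) (x : ℂ) :
    Tendsto (fun y => y * (G y * K (x + y))) (Bornology.cobounded ℂ ⊓ 𝓟 (sector α β))
      (𝓝 0) := by
  obtain ⟨M, hM0, hM⟩ := hG.exists_norm_mul_sector_le hα hβ
  obtain ⟨κ, hκ, hre⟩ := exists_mul_norm_le_re hα hβ
  obtain ⟨B, δ, hδ, hB⟩ := hK.exists_decay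
  have hlim : Tendsto (fun y : ℂ => M * |B| * Real.exp (-δ * x.re) *
      ((‖y‖ + ‖y‖ ^ (1 / 2 : ℝ)) * Real.exp (-(δ * κ) * ‖y‖)))
      (Bornology.cobounded ℂ ⊓ 𝓟 (sector α β)) (𝓝 0) := by
    have hpow (a : ℝ) := (tendsto_rpow_mul_exp_neg_mul_atTop_nhds_zero a (δ * κ)
      (by positivity)).comp (tendsto_norm_cobounded_atTop (E := ℂ))
    simpa [add_mul] using
      (((hpow 1).add (hpow (1 / 2))).const_mul (M * |B| * Real.exp (-δ * x.re))).mono_left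
        inf_le_left
  refine squeeze_zero_norm' ?_ hlim
  have hlarge : ∀ᶠ y in Bornology.cobounded ℂ ⊓ 𝓟 (sector α β), (1 - x.re) / κ ≤ ‖y‖ :=
    (tendsto_norm_cobounded_atTop.eventually_ge_atTop _).filter_mono inf_le_left
  filter_upwards [hlarge, mem_inf_of_right (mem_principal_self _)] with y hlarge hy
  rw [div_le_iff₀' hκ] at hlarge
  have hadd : x.re + κ * ‖y‖ ≤ (x + y).re := by
    rw [add_re]
    exact add_le_add_right (hre y hy) _
  calc ‖y * (G y * K (x + y))‖
      ≤ M * (‖y‖ + ‖y‖ ^ (1 / 2 : ℝ)) * (|B| * Real.exp (-δ * (x.re + κ * ‖y‖))) := by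
        rw [← mul_assoc, norm_mul]
        refine mul_le_mul (hM y hy) ?_ (norm_nonneg _) (by positivity)
        refine (hB _ (by linarith)).trans ?_
        gcongr ?_ * Real.exp ?_
        · exact le_abs_self B
        · exact mul_le_mul_of_nonpos_left hadd (neg_nonpos.2 hδ.le)
    _ = M * |B| * Real.exp (-δ * x.re) *
          ((‖y‖ + ‖y‖ ^ (1 / 2 : ℝ)) * Real.exp (-(δ * κ) * ‖y‖)) := by
        rw [mul_add (-δ), Real.exp_add]
        ring_nf

lemma vanishesAtEnds_mul (hK : IsPoleKernel K) (hG : IsHardyLike G) (hα : |α| < π / 2)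
    (hβ : |β| < π / 2) {x : ℂ} (hx : x ≠ 0) :
    VanishesAtEnds (sector α β) fun y => G y * K (x + y) :=
  ⟨tendsto_mul_zero hK hG hα hβ hx, tendsto_mul_infty hK hG hα hβ x⟩

lemma differentiableAt_mul (hK : IsPoleKernel K) (hG : IsHardyLike G) {x y : ℂ} (hy : 0 < y.re)
    (hxy : x + y ≠ 0) : DifferentiableAt ℂ (fun y => G y * K (x + y)) y :=
  (hG.differentiableAt y hy).mul
    ((hK.differentiableAt hxy).comp y (differentiableAt_id.const_add x))

lemma tendsto_sub_mul_kernel (hK : IsPoleKernel K) (hG : IsHardyLike G) {x : ℂ} (hx : 0 < x.re) :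
    Tendsto (fun y => (y - x) * (G y * K (-x + y))) (𝓝[≠] x) (𝓝 (G x)) := by
  have hGx : Tendsto G (𝓝[≠] x) (𝓝 (G x)) :=
    (hG.differentiableAt x hx).continuousAt.tendsto.mono_left nhdsWithin_le_nhds
  have hsub : Tendsto (fun y => y - x) (𝓝[≠] x) (𝓝[≠] 0) := by
    refine tendsto_nhdsWithin_iff.2 ⟨?_, ?_⟩
    · have hc : Continuous fun y => y - x := by fun_prop
      simpa using (hc.tendsto x).mono_left nhdsWithin_le_nhds
    · filter_upwards [self_mem_nhdsWithin] with y hy using sub_ne_zero.2 hy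
  have hlim := hGx.mul (hK.tendsto_mul.comp hsub)
  rw [mul_one] at hlim
  refine hlim.congr fun y => ?_
  rw [Function.comp_apply, neg_add_eq_sub, mul_left_comm]

theorem rayIntegral_sub_of_neg (hK : IsPoleKernel K) (hG : IsHardyLike G) {x : ℝ} (hx : 0 < x)
    (hα : |α| < π / 2) (hβ : |β| < π / 2) (hα0 : 0 < α) (hβ0 : β < 0)
    (hintα : RayIntegrable (fun y => G y * K (-x + y)) α)
    (hintβ : RayIntegrable (fun y => G y * K (-x + y)) β) :
    rayIntegral (fun y => G y * K (-x + y)) α - rayIntegral (fun y => G y * K (-x + y)) β =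
      -(2 * π * I * G x) := by
  obtain ⟨M, -, hM⟩ := hG.exists_norm_sector_le hβ hα
  refine rayIntegral_sub_eq_residue hx ⟨hα0, ?_⟩ ⟨?_, hβ0⟩ (fun y hy hyx => ?_)
    (vanishesAtEnds_mul hK hG hβ hα (neg_ne_zero.2 (ofReal_ne_zero.2 hx.ne'))) hintα hintβ
    (tendsto_sub_mul_kernel hK hG (by simpa using hx))
  · linarith [le_abs_self α]
  · linarith [neg_abs_le β]
  · exact differentiableAt_mul hK hG (hM y hy).1 (by rwa [neg_add_eq_sub, sub_ne_zero])

end IsHardyLike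

/-- The equation `H f - λ f = c ψ` in the variable `x = s - 1/2`, in which the symbol `ψ` has become
the constant `c`. -/
structure IsSolution (K G : ℂ → ℂ) (lam c : ℂ) : Prop extends IsHardyLike G where
  eqn : ∀ x : ℝ, 0 < x → lam * (G x + c) = ∫ y in Ioi (0 : ℝ), G y * K (x + y)

/-- In the variable `v = log x`, the solution obtained from the integral equation after rotating
the path of integration to the ray of argument `α`. It is analytic for `|Im v - α| < π`. -/
noncomputable def branch (K G : ℂ → ℂ) (lam c : ℂ) (α : ℝ) (v : ℂ) : ℂ :=
  lam⁻¹ * rayIntegral (fun y => G y * K (exp v + y)) α - c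

/-- The analytic continuation of `v ↦ G (exp v)` to the strip `|Im v| < 4π/3`. -/
noncomputable def logCont (K G : ℂ → ℂ) (lam c : ℂ) (v : ℂ) : ℂ :=
  if 0 < v.im then branch K G lam c (π / 3) v else branch K G lam c (-(π / 3)) v

variable {K G : ℂ → ℂ} {lam c : ℂ} {α γ : ℝ}

lemma differentiableAt_branch (hK : IsPoleKernel K) (hG : IsHardyLike G) (hα : |α| < π / 2) {v : ℂ}
    (hv : |v.im - α| < π) : DifferentiableAt ℂ (branch K G lam c α) v := by
  obtain ⟨γ, hγ, hγπ⟩ := exists_between hv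
  obtain ⟨b, hb, hle⟩ := hG.exists_integrable_bound hK hα ⟨(abs_nonneg _).trans_lt hγ, hγπ⟩
    (v.re + 1)
  set s : Set ℂ := {w | |w.im - α| < γ ∧ v.re - 1 < w.re ∧ w.re < v.re + 1}
  have hs : s ∈ 𝓝 v := by
    refine IsOpen.mem_nhds ?_ ⟨hγ, by simp, by simp⟩
    exact (isOpen_lt (f := fun w : ℂ => |w.im - α|) (by fun_prop) continuous_const).inter
      ((isOpen_lt continuous_const continuous_re).inter (isOpen_lt continuous_re continuous_const))
  have hint : DifferentiableAt ℂ
      (fun w => rayIntegral (fun y => G y * K (exp w + y)) α) v := by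
    refine differentiableAt_integral_of_dominated hs
      (fun w hw => (hG.aestronglyMeasurable_ray hK hα (hw.1.trans hγπ)).const_mul _) ?_ ?_
      (hb.mul_const (Real.exp (-(v.re - 1))))
    · filter_upwards [ae_restrict_mem measurableSet_Ioi] with t ht w hw
      have hKw := hK.differentiableAt
        (exp_add_ray_ne_zero (t := t) (hw.1.trans hγπ) (le_of_lt ht))
      exact ((hKw.comp (f := fun w => exp w + exp (α * I) * t) w (by fun_prop)).const_mul
        _).const_mul _
    · filter_upwards [ae_restrict_mem measurableSet_Ioi] with t ht w hw
      rw [norm_mul, norm_exp_ofReal_mul_I, one_mul]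
      refine (hle w hw.1.le hw.2.2.le t ht).trans ?_
      have hb0 : 0 ≤ b t := by
        have := (norm_nonneg _).trans (hle v hγ.le (by simp) t ht)
        exact nonneg_of_mul_nonneg_left this (Real.exp_pos _)
      gcongr
      exact hw.2.1.le
  exact (hint.const_mul _).sub_const c

lemma exists_norm_branch_le (hK : IsPoleKernel K) (hG : IsHardyLike G) (lam c : ℂ)
    (hα : |α| < π / 2) (hγ : γ ∈ Ioo 0 π) :
    ∃ B : ℝ, ∀ v : ℂ, |v.im - α| ≤ γ → v.re ≤ 0 →
      ‖branch K G lam c α v‖ ≤ B * Real.exp (-v.re) := by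
  obtain ⟨b, hb, hle⟩ := hG.exists_integrable_bound hK hα hγ 0
  refine ⟨‖lam⁻¹‖ * (∫ t in Ioi 0, b t) + ‖c‖, fun v hv hv0 => ?_⟩
  have hint : ‖rayIntegral (fun y => G y * K (exp v + y)) α‖ ≤
      (∫ t in Ioi 0, b t) * Real.exp (-v.re) := by
    rw [← integral_mul_const]
    refine norm_integral_le_of_norm_le (hb.mul_const _) ?_
    filter_upwards [ae_restrict_mem measurableSet_Ioi] with t ht
    rw [norm_mul, norm_exp_ofReal_mul_I, one_mul]
    exact hle v hv hv0 t ht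
  calc ‖branch K G lam c α v‖
      ≤ ‖lam⁻¹‖ * ((∫ t in Ioi 0, b t) * Real.exp (-v.re)) + ‖c‖ * Real.exp (-v.re) := by
        refine (norm_sub_le _ _).trans (add_le_add ?_ ?_)
        · rw [norm_mul]
          gcongr
        · exact le_mul_of_one_le_right (norm_nonneg c) (Real.one_le_exp (by linarith))
    _ = (‖lam⁻¹‖ * (∫ t in Ioi 0, b t) + ‖c‖) * Real.exp (-v.re) := by ring

lemma abs_pi_div_three_lt : |π / 3| < π / 2 := by
  rw [abs_of_pos (by positivity)]
  linarith [Real.pi_pos]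

lemma abs_neg_pi_div_three_lt : |-(π / 3)| < π / 2 := by
  rw [abs_neg]
  exact abs_pi_div_three_lt

lemma exists_norm_logCont_le (hK : IsPoleKernel K) (hG : IsHardyLike G) (lam c : ℂ) :
    ∃ B : ℝ, ∀ v : ℂ, |v.im| ≤ π → v.re ≤ 0 → ‖logCont K G lam c v‖ ≤ B * Real.exp (-v.re) := by
  have hγ : 2 * π / 3 ∈ Ioo 0 π := ⟨by positivity, by linarith [Real.pi_pos]⟩
  obtain ⟨B₁, hB₁⟩ := exists_norm_branch_le hK hG lam c abs_pi_div_three_lt hγ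
  obtain ⟨B₂, hB₂⟩ := exists_norm_branch_le hK hG lam c abs_neg_pi_div_three_lt hγ
  refine ⟨max B₁ B₂, fun v hv hv0 => ?_⟩
  have hexp := Real.exp_pos (-v.re)
  rw [abs_le] at hv
  rw [logCont]
  split_ifs with him
  · refine (hB₁ v (abs_le.2 ⟨?_, ?_⟩) hv0).trans (by gcongr; exact le_max_left _ _) <;> linarith
  · refine (hB₂ v (abs_le.2 ⟨?_, ?_⟩) hv0).trans (by gcongr; exact le_max_right _ _) <;> linarith

lemma im_add_pi_mul_I (v : ℂ) : (v + π * I).im = v.im + π := by simp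

lemma im_sub_pi_mul_I (v : ℂ) : (v - π * I).im = v.im - π := by simp

lemma im_add_pi_div_two_mul_I (v : ℂ) : (v + π / 2 * I).im = v.im + π / 2 := by simp

lemma im_sub_pi_div_two_mul_I (v : ℂ) : (v - π / 2 * I).im = v.im - π / 2 := by simp

namespace IsSolution

variable (h : IsSolution K G lam c) (hK : IsPoleKernel K)
include h hK

lemma branch_ofReal (hlam : lam ≠ 0) (hα : |α| < π / 2) (s : ℝ) :
    branch K G lam c α s = G (exp s) := by
  have h0 : |(0 : ℝ)| < π / 2 := by simp [Real.pi_pos]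
  have hv {β : ℝ} (hβ : |β| < π / 2) : |(s : ℂ).im - β| < π := by
    rw [ofReal_im, zero_sub, abs_neg]
    linarith [Real.pi_pos]
  have hcauchy : rayIntegral (fun y => G y * K (exp s + y)) α =
      rayIntegral (fun y => G y * K (exp s + y)) 0 := by
    refine rayIntegral_eq_of_vanishesAtEnds (fun y hy => ?_)
      (h.vanishesAtEnds_mul hK hα h0 (exp_ne_zero _))
      (h.rayIntegrable_mul hK hα (hv hα)) (h.rayIntegrable_mul hK h0 (hv h0))
    obtain ⟨M, -, hM⟩ := h.exists_norm_sector_le hα h0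
    have hre : 0 < (exp s + y).re := by
      rw [add_re, ← ofReal_exp, ofReal_re]
      exact add_pos (Real.exp_pos s) (hM y hy).1
    exact h.differentiableAt_mul hK (hM y hy).1 fun h0 => by simp [h0] at hre
  have heqn := h.eqn (Real.exp s) (Real.exp_pos s)
  have hzero : rayIntegral (fun y => G y * K (exp s + y)) 0 =
      ∫ y in Ioi (0 : ℝ), G y * K (exp s + y) := by
    simp [rayIntegral]
  rw [branch, hcauchy, hzero, ← ofReal_exp, ← heqn, inv_mul_cancel_left₀ hlam, add_sub_cancel_right]

lemma branch_eq (hlam : lam ≠ 0) (hα : |α| < π / 2) {v : ℂ} (hv : |v.im| < π / 2) :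
    branch K G lam c α v = G (exp v) := by
  refine eq_on_strip_of_eq_ofReal Real.pi_div_two_pos (g := fun v => G (exp v)) (fun w hw => ?_)
    (fun w hw => ?_) (fun s => h.branch_ofReal hK hlam hα s) hv
  · refine differentiableAt_branch hK h.toIsHardyLike hα ((abs_sub _ _).trans_lt ?_)
    linarith
  · refine (h.differentiableAt _ ?_).comp w differentiable_exp.differentiableAt
    rw [exp_re]
    exact mul_pos (Real.exp_pos _) (Real.cos_pos_of_mem_Ioo (abs_lt.1 hw))

lemma logCont_eq (hlam : lam ≠ 0) {v : ℂ} (hv : |v.im| < π / 2) :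
    logCont K G lam c v = G (exp v) := by
  rw [logCont]
  split_ifs
  · exact h.branch_eq hK hlam abs_pi_div_three_lt hv
  · exact h.branch_eq hK hlam abs_neg_pi_div_three_lt hv

lemma logCont_eq_branch (hlam : lam ≠ 0) {v : ℂ} (hv : -(π / 2) < v.im) :
    logCont K G lam c v = branch K G lam c (π / 3) v := by
  rcases lt_or_ge 0 v.im with h0 | h0
  · exact if_pos h0
  · have hv' : |v.im| < π / 2 := abs_lt.2 ⟨hv, h0.trans_lt Real.pi_div_two_pos⟩
    rw [h.logCont_eq hK hlam hv', h.branch_eq hK hlam abs_pi_div_three_lt hv']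

lemma logCont_eq_branch_neg (hlam : lam ≠ 0) {v : ℂ} (hv : v.im < π / 2) :
    logCont K G lam c v = branch K G lam c (-(π / 3)) v := by
  rcases lt_or_ge 0 v.im with h0 | h0
  · have hv' : |v.im| < π / 2 := abs_lt.2 ⟨by linarith [Real.pi_pos], hv⟩
    rw [h.logCont_eq hK hlam hv', h.branch_eq hK hlam abs_neg_pi_div_three_lt hv']
  · exact if_neg h0.not_gt

lemma differentiableAt_logCont (hlam : lam ≠ 0) {v : ℂ} (hv : |v.im| < 4 * π / 3) :
    DifferentiableAt ℂ (logCont K G lam c) v := by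
  have hpi := Real.pi_pos
  rw [abs_lt] at hv
  rcases lt_or_ge (-(π / 2)) v.im with h0 | h0
  · refine (differentiableAt_branch (lam := lam) (c := c) hK h.toIsHardyLike abs_pi_div_three_lt
      (abs_lt.2 ⟨?_, ?_⟩)).congr_of_eventuallyEq ?_
    · linarith
    · linarith
    · filter_upwards [(isOpen_lt continuous_const continuous_im).mem_nhds h0] with w hw
        using h.logCont_eq_branch hK hlam hw
  · refine (differentiableAt_branch (lam := lam) (c := c) hK h.toIsHardyLike
      abs_neg_pi_div_three_lt (abs_lt.2 ⟨?_, ?_⟩)).congr_of_eventuallyEq ?_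
    · linarith
    · linarith
    · have h1 : v.im < π / 2 := by linarith
      filter_upwards [(isOpen_lt continuous_im continuous_const).mem_nhds h1] with w hw
        using h.logCont_eq_branch_neg hK hlam hw

lemma branch_sub_branch (s : ℝ) :
    branch K G lam c (π / 3) (s + π * I) - branch K G lam c (-(π / 3)) (s - π * I) =
      -(2 * π * I / lam) * G (exp s) := by
  have hpi := Real.pi_pos
  have hplus : exp (s + π * I) = -(Real.exp s : ℂ) := by
    rw [exp_add, exp_pi_mul_I, mul_neg_one, ofReal_exp]
  have hminus : exp (s - π * I) = -(Real.exp s : ℂ) := by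
    rw [exp_sub, exp_pi_mul_I, div_neg, div_one, ofReal_exp]
  have hrayplus := h.rayIntegrable_mul hK (v := s + π * I) abs_pi_div_three_lt
    (by rw [im_add_pi_mul_I, ofReal_im, abs_lt]; constructor <;> linarith)
  have hrayminus := h.rayIntegrable_mul hK (v := s - π * I) abs_neg_pi_div_three_lt
    (by rw [im_sub_pi_mul_I, ofReal_im, abs_lt]; constructor <;> linarith)
  rw [hplus] at hrayplus
  rw [hminus] at hrayminus
  have hresidue := h.rayIntegral_sub_of_neg hK (Real.exp_pos s) abs_pi_div_three_lt
    abs_neg_pi_div_three_lt (by positivity) (by linarith) hrayplus hrayminus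
  rw [branch, branch, hplus, hminus, sub_sub_sub_cancel_right, ← mul_sub, hresidue, ofReal_exp]
  ring

lemma logCont_jump (hlam : lam ≠ 0) {v : ℂ} (hv : |v.im| < π / 3) :
    logCont K G lam c (v + π * I) - logCont K G lam c (v - π * I) =
      -(2 * π * I / lam) * logCont K G lam c v := by
  have hpi := Real.pi_pos
  have hd {w : ℂ} (hw : |w.im| < 4 * π / 3) := h.differentiableAt_logCont hK hlam hw
  refine eq_on_strip_of_eq_ofReal (by positivity : 0 < π / 3)
    (f := fun v => logCont K G lam c (v + π * I) - logCont K G lam c (v - π * I))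
    (fun w hw => ?_) (fun w hw => (hd (by linarith)).const_mul _) (fun s => ?_) hv
  · rw [abs_lt] at hw
    refine .sub ((hd ?_).comp (f := fun w => w + π * I) w (by fun_prop))
      ((hd ?_).comp (f := fun w => w - π * I) w (by fun_prop))
    · rw [im_add_pi_mul_I, abs_lt]
      constructor <;> linarith
    · rw [im_sub_pi_mul_I, abs_lt]
      constructor <;> linarith
  · rw [h.logCont_eq_branch hK hlam (by rw [im_add_pi_mul_I, ofReal_im]; linarith),
      h.logCont_eq_branch_neg hK hlam (by rw [im_sub_pi_mul_I, ofReal_im]; linarith),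
      h.branch_sub_branch hK,
      h.logCont_eq hK hlam (by simpa using Real.pi_div_two_pos)]

end IsSolution

section Descent

variable {p : ℂ → ℂ} {ε : ℝ}

lemma comp_log_div_two_exp (hε : ε ≤ π)
    (hper : ∀ v : ℂ, |v.im| < ε → p (v + π / 2 * I) = p (v - π / 2 * I)) {v : ℂ}
    (hv : |v.im| < π / 2 + ε) : p (log (exp (2 * v)) / 2) = p v := by
  have hlog {u : ℂ} (h₁ : -(π / 2) < u.im) (h₂ : u.im ≤ π / 2) : log (exp (2 * u)) / 2 = u := by
    have him : (2 * u).im = 2 * u.im := by simp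
    rw [log_exp (by rw [him]; linarith) (by rw [him]; linarith), mul_div_cancel_left₀ _ two_ne_zero]
  rw [abs_lt] at hv
  rcases lt_or_ge (π / 2) v.im with hgt | hle
  · have hshift := hper (v - π / 2 * I)
      (by rw [im_sub_pi_div_two_mul_I, abs_lt]; constructor <;> linarith)
    have hexp : exp (2 * v) = exp (2 * (v - π * I)) := exp_eq_exp_iff_exists_int.2 ⟨1, by ring_nf⟩
    rw [sub_add_cancel, sub_sub, ← add_mul, add_halves] at hshift
    rw [hexp, hlog (by rw [im_sub_pi_mul_I]; linarith) (by rw [im_sub_pi_mul_I]; linarith), hshift]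
  rcases lt_or_ge (-(π / 2)) v.im with hgt | hle'
  · rw [hlog hgt hle]
  · have hshift := hper (v + π / 2 * I)
      (by rw [im_add_pi_div_two_mul_I, abs_lt]; constructor <;> linarith)
    have hexp : exp (2 * v) = exp (2 * (v + π * I)) := exp_eq_exp_iff_exists_int.2 ⟨-1, by
      push_cast; ring_nf⟩
    rw [add_sub_cancel_right, add_assoc, ← add_mul, add_halves] at hshift
    rw [hexp, hlog (by rw [im_add_pi_mul_I]; linarith) (by rw [im_add_pi_mul_I]; linarith), hshift]

lemma abs_log_div_two_im_le (w : ℂ) : |(log w / 2).im| ≤ π / 2 := by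
  rw [div_ofNat_im, abs_div, log_im, abs_of_pos (two_pos : (0 : ℝ) < 2)]
  exact div_le_div_of_nonneg_right (abs_arg_le_pi w) two_pos.le

lemma exp_two_mul_log_div_two {w : ℂ} (hw : w ≠ 0) : exp (2 * (log w / 2)) = w := by
  rw [mul_div_cancel₀ _ two_ne_zero, exp_log hw]

lemma differentiableAt_comp_log_div_two (hε : ε ∈ Ioc 0 π)
    (hd : ∀ v : ℂ, |v.im| < π / 2 + ε → DifferentiableAt ℂ p v)
    (hper : ∀ v : ℂ, |v.im| < ε → p (v + π / 2 * I) = p (v - π / 2 * I)) {w : ℂ} (hw : w ≠ 0) :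
    DifferentiableAt ℂ (fun w => p (log w / 2)) w := by
  set L : ℂ → ℂ := fun w' => log w / 2 + log (w' / w) / 2
  have hLw : L w = log w / 2 := by simp [L, hw]
  have hLd : DifferentiableAt ℂ L w := by
    have hdiv : DifferentiableAt ℂ (fun w' => w' / w) w := differentiableAt_id.div_const w
    refine ((hdiv.clog ?_).div_const 2).const_add _
    rw [div_self hw]
    exact one_mem_slitPlane
  have hexpL {w' : ℂ} (hw' : w' ≠ 0) : exp (2 * L w') = w' := by
    rw [mul_add, exp_add, exp_two_mul_log_div_two hw, exp_two_mul_log_div_two (div_ne_zero hw' hw),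
      mul_div_cancel₀ _ hw]
  have hstrip : |(L w).im| < π / 2 + ε := by
    rw [hLw]
    exact (abs_log_div_two_im_le w).trans_lt (lt_add_of_pos_right _ hε.1)
  refine ((hd _ hstrip).comp w hLd).congr_of_eventuallyEq ?_
  have hc : ContinuousAt (fun w' => |(L w').im|) w :=
    (continuous_abs.comp continuous_im).continuousAt.comp hLd.continuousAt
  filter_upwards [hc.eventually_lt_const hstrip, isOpen_ne.mem_nhds hw] with w' hw' hne
  have := comp_log_div_two_exp hε.2 hper hw'
  rwa [hexpL hne] at this

/-- A function of period `π i` is a function of `w = exp (2v)`, and the end `Re v → -∞` of the strip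
becomes a removable singularity at `w = 0`. -/
theorem exists_entire_comp_exp (hε : ε ∈ Ioc 0 π)
    (hd : ∀ v : ℂ, |v.im| < π / 2 + ε → DifferentiableAt ℂ p v)
    (hper : ∀ v : ℂ, |v.im| < ε → p (v + π / 2 * I) = p (v - π / 2 * I))
    (h0 : Tendsto (fun v => exp (2 * v) * p v) (comap re atBot ⊓ 𝓟 {v | |v.im| ≤ π / 2}) (𝓝 0)) :
    ∃ H : ℂ → ℂ, Differentiable ℂ H ∧ ∀ v : ℂ, |v.im| < π / 2 + ε → p v = H (exp (2 * v)) := by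
  set H : ℂ → ℂ := fun w => p (log w / 2)
  have hlim : Tendsto (fun w => (w - 0) * H w) (𝓝[≠] 0) (𝓝 0) := by
    have hlog : Tendsto (fun w => log w / 2) (𝓝[≠] 0)
        (comap re atBot ⊓ 𝓟 {v | |v.im| ≤ π / 2}) := by
      refine tendsto_inf.2 ⟨tendsto_comap_iff.2 ?_, tendsto_principal.2
        (.of_forall abs_log_div_two_im_le)⟩
      have hre := (Real.tendsto_log_nhdsGT_zero.comp
        (tendsto_norm_nhdsNE_zero (E := ℂ))).atBot_div_const (two_pos : (0 : ℝ) < 2)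
      simpa [Function.comp_def, log_re] using hre
    refine (h0.comp hlog).congr' ?_
    filter_upwards [self_mem_nhdsWithin] with w hw
    rw [Function.comp_apply, exp_two_mul_log_div_two hw, sub_zero]
  refine ⟨_, differentiableOn_univ.1 (differentiableOn_update_limUnder_of_tendsto univ_mem
    (fun w hw => (differentiableAt_comp_log_div_two hε hd hper hw.2).differentiableWithinAt) hlim),
    fun v hv => ?_⟩
  rw [Function.update_of_ne (exp_ne_zero _)]
  exact (comp_log_div_two_exp hε.2 hper hv).symm

end Descent

lemma eq_zero_of_tendsto_mul_exp {θ : ℝ} {p : ℂ}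
    (h : Tendsto (fun s : ℝ => p * exp (I * θ * s)) atBot (𝓝 0)) : p = 0 := by
  have hnorm (s : ℝ) : ‖p * exp (I * θ * s)‖ = ‖p‖ := by
    rw [norm_mul, norm_exp]
    simp
  have hlim := h.norm
  simp only [hnorm, norm_zero] at hlim
  exact norm_eq_zero.1 (tendsto_nhds_unique tendsto_const_nhds hlim)

/-- Translating by a quarter period multiplies the two exponentials by different constants, which
allows one of them to be eliminated. -/
lemma eq_zero_of_tendsto_add_exp {θ : ℝ} (hθ : θ ≠ 0) {p q : ℂ}
    (h : Tendsto (fun s : ℝ => p * exp (I * θ * s) + q * exp (-(I * θ * s))) atBot (𝓝 0)) :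
    p = 0 := by
  have hquarter : I * θ * (π / (2 * θ) : ℝ) = π / 2 * I := by
    have hθ' : (θ : ℂ) ≠ 0 := ofReal_ne_zero.2 hθ
    push_cast
    field_simp
  have hshift := h.comp (tendsto_atBot_add_const_right atBot (π / (2 * θ)) tendsto_id)
  have hlim := h.sub (hshift.const_mul I)
  rw [mul_zero, sub_zero] at hlim
  have htwo : (2 : ℂ) * p = 0 := by
    refine eq_zero_of_tendsto_mul_exp (θ := θ) (hlim.congr fun s => ?_)
    rw [Function.comp_apply, id, ofReal_add, mul_add (I * θ), neg_add, exp_add, exp_add, hquarter,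
      exp_neg (π / 2 * I), exp_pi_div_two_mul_I, inv_I]
    linear_combination (-p * exp (I * θ * s) + q * exp (-(I * θ * s))) * I_mul_I
  exact (mul_eq_zero.1 htwo).resolve_left two_ne_zero

lemma exp_pi_mul_I_mul_exponent (θ : ℝ) :
    exp (π * I * (-(1 / 2) - I * θ)) = -I * Real.exp (π * θ) := by
  have hsplit : π * I * (-(1 / 2) - I * θ) = -(π / 2 * I) + (π * θ : ℝ) := by
    push_cast
    linear_combination (-(π : ℂ) * θ) * I_mul_I
  rw [hsplit, exp_add, exp_neg, exp_pi_div_two_mul_I, inv_I, ofReal_exp]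

/-- A function analytic in a strip, of controlled growth to the left, satisfying a second order
difference equation with step `π i`. -/
structure IsRecurrent (g : ℂ → ℂ) (b : ℂ) : Prop where
  differentiableAt : ∀ v : ℂ, |v.im| < 4 * π / 3 → DifferentiableAt ℂ g v
  exists_norm_le : ∃ B : ℝ, ∀ v : ℂ, |v.im| ≤ π → v.re ≤ 0 → ‖g v‖ ≤ B * Real.exp (-v.re)
  jump : ∀ v : ℂ, |v.im| < π / 3 → g (v + π * I) - g (v - π * I) = b * g v

lemma IsSolution.isRecurrent {K G : ℂ → ℂ} {lam c : ℂ} (h : IsSolution K G lam c)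
    (hK : IsPoleKernel K) (hlam : lam ≠ 0) :
    IsRecurrent (logCont K G lam c) (-(2 * π * I / lam)) :=
  ⟨fun _ hv => h.differentiableAt_logCont hK hlam hv,
    exists_norm_logCont_le hK h.toIsHardyLike lam c, fun _ hv => h.logCont_jump hK hlam hv⟩

namespace IsRecurrent

variable {g : ℂ → ℂ} {b z r r' : ℂ}

lemma differentiableAt_component (h : IsRecurrent g b) (z r' : ℂ) {v : ℂ}
    (hv : |v.im| < π / 2 + π / 3) :
    DifferentiableAt ℂ
      (fun v => exp (-(z * v)) * (g (v + π / 2 * I) - r' * g (v - π / 2 * I))) v := by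
  rw [abs_lt] at hv
  have hplus : DifferentiableAt ℂ (fun v => g (v + π / 2 * I)) v := by
    refine (h.differentiableAt _ ?_).comp (f := fun v => v + π / 2 * I) v (by fun_prop)
    rw [im_add_pi_div_two_mul_I, abs_lt]
    constructor <;> linarith
  have hminus : DifferentiableAt ℂ (fun v => g (v - π / 2 * I)) v := by
    refine (h.differentiableAt _ ?_).comp (f := fun v => v - π / 2 * I) v (by fun_prop)
    rw [im_sub_pi_div_two_mul_I, abs_lt]
    constructor <;> linarith
  exact .mul (by fun_prop) (hplus.sub (hminus.const_mul r'))

lemma component_periodic (h : IsRecurrent g b) (hz : exp (π * I * z) = r) (hr : r * r' = -1)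
    (hb : r + r' = b) {v : ℂ} (hv : |v.im| < π / 3) :
    exp (-(z * (v + π / 2 * I))) *
        (g (v + π / 2 * I + π / 2 * I) - r' * g (v + π / 2 * I - π / 2 * I)) =
      exp (-(z * (v - π / 2 * I))) *
        (g (v - π / 2 * I + π / 2 * I) - r' * g (v - π / 2 * I - π / 2 * I)) := by
  have hexp : exp (-(z * (v - π / 2 * I))) = exp (-(z * (v + π / 2 * I))) * r := by
    rw [← hz, ← exp_add]
    ring_nf
  have hjump := h.jump v hv
  rw [← hb] at hjump
  rw [hexp, add_sub_cancel_right, sub_add_cancel, add_assoc, sub_sub, ← add_mul, add_halves]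
  linear_combination exp (-(z * (v + π / 2 * I))) * (hjump + g (v - π * I) * hr)

lemma exists_norm_sub_const_mul_le (h : IsRecurrent g b) (r' : ℂ) :
    ∃ B : ℝ, ∀ v : ℂ, |v.im| ≤ π / 2 → v.re ≤ 0 →
      ‖g (v + π / 2 * I) - r' * g (v - π / 2 * I)‖ ≤ B * Real.exp (-v.re) := by
  obtain ⟨B, hB⟩ := h.exists_norm_le
  refine ⟨B + ‖r'‖ * B, fun v hv hv0 => ?_⟩
  have him := abs_le.1 hv
  have hplus : ‖g (v + π / 2 * I)‖ ≤ B * Real.exp (-v.re) := by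
    simpa using hB (v + π / 2 * I)
      (by rw [im_add_pi_div_two_mul_I, abs_le]; constructor <;> linarith)
      (by simpa using hv0)
  have hminus : ‖g (v - π / 2 * I)‖ ≤ B * Real.exp (-v.re) := by
    simpa using hB (v - π / 2 * I)
      (by rw [im_sub_pi_div_two_mul_I, abs_le]; constructor <;> linarith)
      (by simpa using hv0)
  calc ‖g (v + π / 2 * I) - r' * g (v - π / 2 * I)‖
      ≤ ‖g (v + π / 2 * I)‖ + ‖r'‖ * ‖g (v - π / 2 * I)‖ := by
        simpa only [norm_mul] using norm_sub_le (g (v + π / 2 * I)) (r' * g (v - π / 2 * I))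
    _ ≤ B * Real.exp (-v.re) + ‖r'‖ * (B * Real.exp (-v.re)) := by gcongr
    _ = (B + ‖r'‖ * B) * Real.exp (-v.re) := by ring

lemma tendsto_component (h : IsRecurrent g b) (hz : z.re < 1) (r' : ℂ) :
    Tendsto (fun v => exp (2 * v) *
        (exp (-(z * v)) * (g (v + π / 2 * I) - r' * g (v - π / 2 * I))))
      (comap re atBot ⊓ 𝓟 {v | |v.im| ≤ π / 2}) (𝓝 0) := by
  obtain ⟨B, hB⟩ := h.exists_norm_sub_const_mul_le r'
  set C := Real.exp (|z.im| * (π / 2)) * B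
  have hlim : Tendsto (fun v : ℂ => C * Real.exp ((1 - z.re) * v.re))
      (comap re atBot ⊓ 𝓟 {v | |v.im| ≤ π / 2}) (𝓝 0) := by
    have hre := (tendsto_comap (f := re)).mono_left
      (inf_le_left (a := comap re atBot) (b := 𝓟 {v | |v.im| ≤ π / 2}))
    simpa using (Real.tendsto_exp_atBot.comp
      (hre.const_mul_atBot (sub_pos.2 hz))).const_mul C
  refine squeeze_zero_norm' ?_ hlim
  filter_upwards [(tendsto_comap.eventually (eventually_le_atBot 0)).filter_mono inf_le_left,
    mem_inf_of_right (mem_principal_self _)] with v hv0 hv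
  have hzim : z.im * v.im ≤ |z.im| * (π / 2) := by
    refine (le_abs_self _).trans ?_
    rw [abs_mul]
    exact mul_le_mul_of_nonneg_left hv (abs_nonneg _)
  have hre : (2 * v + -(z * v)).re = 2 * v.re - z.re * v.re + z.im * v.im := by
    simp only [add_re, mul_re, re_ofNat, im_ofNat, zero_mul, sub_zero, neg_re, neg_sub]
    ring
  calc ‖exp (2 * v) * (exp (-(z * v)) * (g (v + π / 2 * I) - r' * g (v - π / 2 * I)))‖
      ≤ Real.exp (2 * v.re + (|z.im| * (π / 2) - z.re * v.re)) * (B * Real.exp (-v.re)) := by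
        rw [← mul_assoc, ← exp_add, norm_mul, norm_exp, hre]
        exact mul_le_mul (Real.exp_le_exp.2 (by linarith)) (hB v hv hv0) (norm_nonneg _)
          (Real.exp_pos _).le
    _ = C * (Real.exp (2 * v.re) * Real.exp (-(z.re * v.re)) * Real.exp (-v.re)) := by
        rw [Real.exp_add, sub_eq_add_neg, Real.exp_add]
        ring
    _ = C * Real.exp ((1 - z.re) * v.re) := by
        rw [← Real.exp_add, ← Real.exp_add]
        ring_nf

/-- Eliminating one of the two characteristic roots `r`, `r'` leaves a quasi-periodic function. -/
theorem exists_entire (h : IsRecurrent g b) (hz : exp (π * I * z) = r) (hr : r * r' = -1)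
    (hb : r + r' = b) (hzre : z.re < 1) :
    ∃ H : ℂ → ℂ, Differentiable ℂ H ∧ ∀ v : ℂ, |v.im| < π / 2 + π / 3 →
      g (v + π / 2 * I) - r' * g (v - π / 2 * I) = exp (z * v) * H (exp (2 * v)) := by
  obtain ⟨H, hH, hpH⟩ := exists_entire_comp_exp ⟨by positivity, by linarith [Real.pi_pos]⟩
    (fun _ hv => h.differentiableAt_component z r' hv)
    (fun _ hv => h.component_periodic hz hr hb hv) (h.tendsto_component hzre r')
  refine ⟨H, hH, fun v hv => ?_⟩
  rw [← hpH v hv, ← mul_assoc, ← exp_add, add_neg_cancel, exp_zero, one_mul]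

theorem exists_entire_pair_of_roots {z₁ z₂ r₁ r₂ : ℂ} (h : IsRecurrent g b)
    (hz₁ : exp (π * I * z₁) = r₁) (hz₂ : exp (π * I * z₂) = r₂) (hprod : r₁ * r₂ = -1)
    (hsum : r₁ + r₂ = b) (hne : r₁ ≠ r₂) (hre₁ : z₁.re < 1) (hre₂ : z₂.re < 1) :
    ∃ H₁ H₂ : ℂ → ℂ, Differentiable ℂ H₁ ∧ Differentiable ℂ H₂ ∧ ∀ v : ℂ, |v.im| < π / 3 →
      g v = exp (z₁ * v) * H₁ (exp (2 * v)) + exp (z₂ * v) * H₂ (exp (2 * v)) := by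
  obtain ⟨H₁, hd₁, hH₁⟩ := h.exists_entire hz₁ hprod hsum hre₁
  obtain ⟨H₂, hd₂, hH₂⟩ := h.exists_entire hz₂ (by rwa [mul_comm]) (by rwa [add_comm]) hre₂
  refine ⟨fun w => (r₁ - r₂)⁻¹ * exp (z₁ * (π / 2 * I)) * H₁ (-w),
    fun w => -(r₁ - r₂)⁻¹ * exp (z₂ * (π / 2 * I)) * H₂ (-w),
    (hd₁.comp differentiable_neg).const_mul _, (hd₂.comp differentiable_neg).const_mul _,
    fun v hv => ?_⟩
  have hv' : |(v + π / 2 * I).im| < π / 2 + π / 3 := by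
    rw [im_add_pi_div_two_mul_I]
    rw [abs_lt] at hv ⊢
    constructor <;> linarith
  have hexp : exp (2 * (v + π / 2 * I)) = -exp (2 * v) := by
    rw [mul_add, exp_add, ← mul_assoc, mul_div_cancel₀ _ two_ne_zero, exp_pi_mul_I, mul_neg_one]
  have heq₁ := hH₁ _ hv'
  have heq₂ := hH₂ _ hv'
  rw [add_sub_cancel_right, hexp, mul_add, exp_add] at heq₁ heq₂
  linear_combination (r₁ - r₂)⁻¹ * (heq₁ - heq₂) - g v * inv_mul_cancel₀ (sub_ne_zero.2 hne)

theorem exists_entire_pair {θ : ℝ} (h : IsRecurrent g (-(2 * I * Real.cosh (π * θ)))) (hθ : θ ≠ 0) :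
    ∃ H₁ H₂ : ℂ → ℂ, Differentiable ℂ H₁ ∧ Differentiable ℂ H₂ ∧ ∀ v : ℂ, |v.im| < π / 3 →
      g v = exp ((-(1 / 2) - I * θ) * v) * H₁ (exp (2 * v)) +
        exp ((-(1 / 2) + I * θ) * v) * H₂ (exp (2 * v)) := by
  have hneg : exp (π * I * (-(1 / 2) + I * θ)) = -I * Real.exp (-(π * θ)) := by
    simpa using exp_pi_mul_I_mul_exponent (-θ)
  refine h.exists_entire_pair_of_roots (exp_pi_mul_I_mul_exponent θ) hneg ?_ ?_ ?_ (by norm_num)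
    (by norm_num)
  · have : (Real.exp (π * θ) : ℂ) * Real.exp (-(π * θ)) = 1 := by
      rw [← ofReal_mul, ← Real.exp_add, add_neg_cancel, Real.exp_zero, ofReal_one]
    linear_combination I * I * this + I_mul_I
  · rw [Real.cosh_eq]
    push_cast
    ring
  · rw [Ne, mul_right_inj' (neg_ne_zero.2 I_ne_zero), ofReal_inj, Real.exp_eq_exp]
    have := mul_ne_zero Real.pi_ne_zero hθ
    contrapose! this
    linarith

end IsRecurrent

section Theta

variable {lam : ℝ}

lemma exp_pi_mul_theta (h0 : 0 < lam) :
    Real.exp (π * theta lam) = π / lam - √((π / lam) ^ 2 - 1) := by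
  have hlt : √((π / lam) ^ 2 - 1) < π / lam := by
    rw [Real.sqrt_lt' (by positivity)]
    linarith
  rw [theta, ← mul_assoc, mul_one_div_cancel Real.pi_ne_zero, one_mul,
    Real.exp_log (sub_pos.2 hlt)]

lemma sq_pi_div_sub_one_pos (h0 : 0 < lam) (hpi : lam < π) : 0 < (π / lam) ^ 2 - 1 :=
  sub_pos.2 (one_lt_pow₀ ((one_lt_div h0).2 hpi) two_ne_zero)

lemma cosh_pi_mul_theta (h0 : 0 < lam) (hpi : lam < π) : Real.cosh (π * theta lam) = π / lam := by
  have hsq := Real.sq_sqrt (sq_pi_div_sub_one_pos h0 hpi).le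
  have hinv : (π / lam - √((π / lam) ^ 2 - 1))⁻¹ = π / lam + √((π / lam) ^ 2 - 1) :=
    inv_eq_of_mul_eq_one_right (by linear_combination -hsq)
  rw [Real.cosh_eq, Real.exp_neg, exp_pi_mul_theta h0, hinv]
  ring

lemma theta_ne_zero (h0 : 0 < lam) (hpi : lam < π) : theta lam ≠ 0 := fun h => by
  have hcosh := cosh_pi_mul_theta h0 hpi
  rw [h, mul_zero, Real.cosh_zero] at hcosh
  exact ((one_lt_div h0).2 hpi).ne hcosh

end Theta

lemma exists_entire_eq_mul {H : ℂ → ℂ} (hH : Differentiable ℂ H) (h0 : H 0 = 0) :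
    ∃ J : ℂ → ℂ, Differentiable ℂ J ∧ ∀ w, H w = w * J w := by
  refine ⟨dslope H 0, ?_, fun w => ?_⟩
  · rw [← differentiableOn_univ] at hH ⊢
    exact (differentiableOn_dslope univ_mem).2 hH
  · simpa [h0] using (sub_smul_dslope H 0 w).symm

lemma tendsto_sub_mul_exp {H : ℂ → ℂ} (hH : Continuous H) (b : ℝ) :
    Tendsto (fun s : ℝ => (H (exp (2 * s)) - H 0) * exp (I * b * s)) atBot (𝓝 0) := by
  have hexp : Tendsto (fun s : ℝ => exp (2 * (s : ℂ))) atBot (𝓝 0) :=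
    tendsto_exp_comap_re_atBot.comp (tendsto_comap_iff.2 (by
      simpa [Function.comp_def] using tendsto_id.const_mul_atBot two_pos))
  have hsub : Tendsto (fun s : ℝ => ‖H (exp (2 * s)) - H 0‖) atBot (𝓝 0) := by
    simpa using (((hH.tendsto 0).comp hexp).sub_const (H 0)).norm
  refine squeeze_zero_norm (fun s => le_of_eq ?_) hsub
  rw [norm_mul, norm_exp]
  simp

/-- The square-summability of the coefficients enters here: it kills the values at `0` of both
entire functions, hence the exponents `-1/2 ± iθ`, and raises them to `3/2 ± iθ`. -/
theorem IsRecurrent.exists_decomposition {g : ℂ → ℂ} {θ : ℝ} (hθ : θ ≠ 0)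
    (h : IsRecurrent g (-(2 * I * Real.cosh (π * θ))))
    (h0 : Tendsto (fun s : ℝ => exp (s / 2) * g s) atBot (𝓝 0)) :
    ∃ J₁ J₂ : ℂ → ℂ, Differentiable ℂ J₁ ∧ Differentiable ℂ J₂ ∧ ∀ v : ℂ, |v.im| < π / 3 →
      g v = exp ((3 / 2 - I * θ) * v) * J₁ (exp (2 * v)) +
        exp ((3 / 2 + I * θ) * v) * J₂ (exp (2 * v)) := by
  obtain ⟨H₁, H₂, hd₁, hd₂, hH⟩ := h.exists_entire_pair hθ
  have hosc : Tendsto (fun s : ℝ => H₂ 0 * exp (I * θ * s) + H₁ 0 * exp (-(I * θ * s)))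
      atBot (𝓝 0) := by
    have hlim := (h0.sub (tendsto_sub_mul_exp hd₁.continuous (-θ))).sub
      (tendsto_sub_mul_exp hd₂.continuous θ)
    simp only [sub_zero] at hlim
    refine hlim.congr fun s => ?_
    have hexp₁ : exp (s / 2) * exp ((-(1 / 2) - I * θ) * s) = exp (-(I * θ * s)) := by
      rw [← exp_add]
      ring_nf
    have hexp₂ : exp (s / 2) * exp ((-(1 / 2) + I * θ) * s) = exp (I * θ * s) := by
      rw [← exp_add]
      ring_nf
    rw [hH s (by simp [Real.pi_pos]), ofReal_neg, mul_neg, neg_mul]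
    linear_combination H₁ (exp (2 * s)) * hexp₁ + H₂ (exp (2 * s)) * hexp₂
  have hosc' : Tendsto (fun s : ℝ => H₁ 0 * exp (I * (-θ : ℝ) * s) +
      H₂ 0 * exp (-(I * (-θ : ℝ) * s))) atBot (𝓝 0) := hosc.congr fun s => by simp [add_comm]
  obtain ⟨J₁, hJ₁, hHJ₁⟩ := exists_entire_eq_mul hd₁
    (eq_zero_of_tendsto_add_exp (neg_ne_zero.2 hθ) hosc')
  obtain ⟨J₂, hJ₂, hHJ₂⟩ := exists_entire_eq_mul hd₂ (eq_zero_of_tendsto_add_exp hθ hosc)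
  refine ⟨J₁, J₂, hJ₁, hJ₂, fun v hv => ?_⟩
  rw [hH v hv, hHJ₁, hHJ₂, ← mul_assoc, ← mul_assoc, ← exp_add, ← exp_add]
  ring_nf

theorem IsSolution.exists_decomposition {K G : ℂ → ℂ} {lam : ℝ} {c : ℂ}
    (h : IsSolution K G lam c) (hK : IsPoleKernel K) (hlam0 : 0 < lam) (hlampi : lam < π)
    (h0 : Tendsto (fun x : ℝ => √x * G x) (𝓝[>] 0) (𝓝 0)) :
    ∃ J₁ J₂ : ℂ → ℂ, Differentiable ℂ J₁ ∧ Differentiable ℂ J₂ ∧ ∀ x : ℝ, 0 < x →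
      G x = (x : ℂ) ^ (3 / 2 - I * theta lam) * J₁ (x ^ 2) +
        (x : ℂ) ^ (3 / 2 + I * theta lam) * J₂ (x ^ 2) := by
  have hlam : (lam : ℂ) ≠ 0 := ofReal_ne_zero.2 hlam0.ne'
  have heq (s : ℝ) : logCont K G lam c s = G (Real.exp s) := by
    rw [h.logCont_eq hK hlam (by simp [Real.pi_pos]), ofReal_exp]
  have hrec := h.isRecurrent hK hlam
  have hb : -(2 * π * I / lam) = -(2 * I * Real.cosh (π * theta lam)) := by
    rw [cosh_pi_mul_theta hlam0 hlampi]
    push_cast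
    ring
  rw [hb] at hrec
  have hexp : Tendsto Real.exp atBot (𝓝[>] 0) :=
    tendsto_nhdsWithin_iff.2 ⟨Real.tendsto_exp_atBot, .of_forall Real.exp_pos⟩
  obtain ⟨J₁, J₂, hJ₁, hJ₂, hJ⟩ := hrec.exists_decomposition (theta_ne_zero hlam0 hlampi) <|
    (h0.comp hexp).congr fun s => by
      rw [heq, Function.comp_apply, ← Real.exp_half]
      push_cast
      rfl
  refine ⟨J₁, J₂, hJ₁, hJ₂, fun x hx => ?_⟩
  have hx0 : (x : ℂ) ≠ 0 := ofReal_ne_zero.2 hx.ne'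
  have hlog : exp (Real.log x) = x := by rw [← ofReal_exp, Real.exp_log hx]
  have hlog2 : exp (2 * Real.log x) = (x : ℂ) ^ 2 := by
    rw [two_mul, exp_add, hlog, sq]
  have hJx := hJ (Real.log x) (by simp [Real.pi_pos])
  rw [heq, Real.exp_log hx, hlog2] at hJx
  rw [hJx, cpow_def_of_ne_zero hx0, cpow_def_of_ne_zero hx0, ← ofReal_log hx.le,
    mul_comm (Real.log x : ℂ), mul_comm (Real.log x : ℂ)]

section DirichletSeries

variable {a : ℕ → ℂ} {s : ℂ} {σ : ℝ}

lemma norm_term_eq_mul_rpow (a : ℕ → ℂ) (hs : s.re ≠ 0) (n : ℕ) :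
    ‖LSeries.term a s n‖ = ‖a n‖ * (n : ℝ) ^ (-s.re) := by
  rcases eq_or_ne n 0 with rfl | hn
  · simp [Real.zero_rpow (neg_ne_zero.2 hs)]
  · rw [LSeries.norm_term_eq, if_neg hn, Real.rpow_neg n.cast_nonneg, div_eq_mul_inv]

lemma norm_term_le_exp_mul_norm_term (ha : a 1 = 0) (hs : σ ≤ s.re) (n : ℕ) :
    ‖LSeries.term a s n‖ ≤ Real.exp (-Real.log 2 * (s.re - σ)) * ‖LSeries.term a σ n‖ := by
  match n with
  | 0 => simp
  | 1 => simp [ha]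
  | n + 2 =>
    have hn : (0 : ℝ) < (n + 2 : ℕ) := by positivity
    have hpow : Real.exp (Real.log 2 * (s.re - σ)) * ((n + 2 : ℕ) : ℝ) ^ σ ≤
        ((n + 2 : ℕ) : ℝ) ^ s.re := by
      rw [← sub_add_cancel s.re σ, Real.rpow_add hn, sub_add_cancel,
        ← Real.rpow_def_of_pos two_pos]
      have := sub_nonneg.2 hs
      gcongr
      push_cast
      linarith [n.cast_nonneg (α := ℝ)]
    rw [LSeries.norm_term_eq, LSeries.norm_term_eq, if_neg (by simp), if_neg (by simp), ofReal_re,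
      neg_mul, Real.exp_neg, mul_div_assoc', inv_mul_eq_div, div_div]
    gcongr

lemma exists_norm_LSeries_le_exp (ha : a 1 = 0) (h : LSeriesSummable a σ) :
    ∃ B : ℝ, ∀ s : ℂ, σ ≤ s.re → ‖LSeries a s‖ ≤ B * Real.exp (-Real.log 2 * s.re) := by
  refine ⟨Real.exp (Real.log 2 * σ) * ∑' n, ‖LSeries.term a σ n‖, fun s hs => ?_⟩
  calc ‖LSeries a s‖
      ≤ Real.exp (-Real.log 2 * (s.re - σ)) * ∑' n, ‖LSeries.term a σ n‖ :=
        tsum_of_norm_bounded (h.norm.hasSum.mul_left _) (norm_term_le_exp_mul_norm_term ha hs)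
    _ = Real.exp (Real.log 2 * σ) * (∑' n, ‖LSeries.term a σ n‖) *
          Real.exp (-Real.log 2 * s.re) := by
        rw [mul_sub, neg_mul, neg_mul, sub_neg_eq_add, Real.exp_add]
        ring

lemma tsum_nat_rpow_neg_le {p : ℝ} (hp : 1 < p) : ∑' n : ℕ, (n : ℝ) ^ (-p) ≤ 1 + (p - 1)⁻¹ := by
  have hzeta := ZetaAsymptotics.zeta_limit_aux1 hp
  have hnn : 0 ≤ p * ZetaAsymptotics.termTSum p :=
    mul_nonneg (by linarith) (tsum_nonneg fun n => ZetaAsymptotics.term_nonneg _ _)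
  have hshift : ∑' n : ℕ, (n : ℝ) ^ (-p) = ∑' n : ℕ, 1 / (n + 1 : ℝ) ^ p := by
    rw [(Real.summable_nat_rpow.2 (neg_lt_neg hp)).tsum_eq_zero_add, Nat.cast_zero,
      Real.zero_rpow (by linarith), zero_add]
    refine tsum_congr fun n => ?_
    rw [Real.rpow_neg (by positivity), one_div, Nat.cast_add_one]
  rw [hshift, ← one_div]
  linarith

lemma add_half_re (y : ℂ) : (y + 1 / 2).re = y.re + 1 / 2 := by
  rw [add_re]
  norm_num

/-- Cauchy–Schwarz against `∑ n ^ (-1 - 2σ) ≤ 1 + 1 / (2σ)`. -/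
theorem summable_and_tsum_norm_term_le (ha : Summable fun n => ‖a n‖ ^ 2) {y : ℂ}
    (hy : 0 < y.re) :
    (Summable fun n => ‖LSeries.term a (y + 1 / 2) n‖) ∧
      ∑' n, ‖LSeries.term a (y + 1 / 2) n‖ ≤
        √(∑' n, ‖a n‖ ^ 2) * (1 + y.re ^ (-(1 / 2) : ℝ)) := by
  have hp : 1 < 1 + 2 * y.re := by linarith
  have hsq (n : ℕ) : ((n : ℝ) ^ (-(y.re + 1 / 2))) ^ (2 : ℝ) = (n : ℝ) ^ (-(1 + 2 * y.re)) := by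
    rw [← Real.rpow_mul n.cast_nonneg]
    ring_nf
  have hterm (n : ℕ) : ‖LSeries.term a (y + 1 / 2) n‖ = ‖a n‖ * (n : ℝ) ^ (-(y.re + 1 / 2)) := by
    rw [norm_term_eq_mul_rpow a (by rw [add_half_re]; positivity), add_half_re]
  obtain ⟨hsum, hle⟩ := Real.summable_and_inner_le_Lp_mul_Lq_tsum_of_nonneg
    Real.HolderConjugate.two_two (f := fun n => ‖a n‖) (fun n => norm_nonneg _)
    (g := fun n : ℕ => (n : ℝ) ^ (-(y.re + 1 / 2))) (fun n => by positivity) (by simpa using ha)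
    (by simpa only [hsq] using Real.summable_nat_rpow.2 (neg_lt_neg hp))
  simp only [hterm]
  refine ⟨hsum, hle.trans ?_⟩
  simp only [hsq, Real.rpow_two, ← Real.sqrt_eq_rpow]
  gcongr
  rw [Real.sqrt_le_left (by positivity)]
  have hinv : (y.re ^ (-(1 / 2) : ℝ)) ^ 2 = y.re⁻¹ := by
    rw [← Real.rpow_mul_natCast hy.le, ← Real.rpow_neg_one]
    norm_num
  calc ∑' n : ℕ, (n : ℝ) ^ (-(1 + 2 * y.re)) ≤ 1 + (1 + 2 * y.re - 1)⁻¹ := tsum_nat_rpow_neg_le hp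
    _ ≤ 1 + y.re⁻¹ := by
        gcongr
        linarith
    _ ≤ (1 + y.re ^ (-(1 / 2) : ℝ)) ^ 2 := by
        rw [add_sq, hinv]
        have : 0 ≤ y.re ^ (-(1 / 2) : ℝ) := by positivity
        linarith

lemma norm_LSeries_add_half_le (ha : Summable fun n => ‖a n‖ ^ 2) {y : ℂ} (hy : 0 < y.re) :
    ‖LSeries a (y + 1 / 2)‖ ≤ √(∑' n, ‖a n‖ ^ 2) * (1 + y.re ^ (-(1 / 2) : ℝ)) := by
  obtain ⟨hsum, hle⟩ := summable_and_tsum_norm_term_le ha hy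
  exact (norm_tsum_le_tsum_norm hsum).trans hle

lemma norm_LSeries_sub_sum_le (ha : Summable fun n => ‖a n‖ ^ 2) (S : Finset ℕ) {y : ℂ}
    (hy : 0 < y.re) :
    ‖LSeries a (y + 1 / 2) - ∑ n ∈ S, LSeries.term a (y + 1 / 2) n‖ ≤
      √(∑' n : {n // n ∉ S}, ‖a n‖ ^ 2) * (1 + y.re ^ (-(1 / 2) : ℝ)) := by
  set b : ℕ → ℂ := indicator (↑S)ᶜ a
  have hb : (fun n => ‖b n‖ ^ 2) = indicator (↑S)ᶜ fun n => ‖a n‖ ^ 2 := by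
    ext n
    by_cases hn : n ∈ S <;> simp [b, hn]
  have htail : ∑' n : {n // n ∉ S}, ‖a n‖ ^ 2 = ∑' n, ‖b n‖ ^ 2 := by
    rw [hb]
    exact tsum_subtype (↑S)ᶜ fun n => ‖a n‖ ^ 2
  have hterm : LSeries.term b (y + 1 / 2) = indicator (↑S)ᶜ (LSeries.term a (y + 1 / 2)) := by
    ext n
    by_cases hn : n ∈ S <;> simp [b, hn, LSeries.term]
  have hdiff : LSeries a (y + 1 / 2) - ∑ n ∈ S, LSeries.term a (y + 1 / 2) n =
      LSeries b (y + 1 / 2) := by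
    have hsum : Summable (LSeries.term a (y + 1 / 2)) :=
      (summable_and_tsum_norm_term_le ha hy).1.of_norm
    rw [LSeries, LSeries, hterm, ← tsum_subtype, ← hsum.sum_add_tsum_compl (s := S),
      add_sub_cancel_left]
  rw [hdiff, htail]
  exact norm_LSeries_add_half_le (hb ▸ ha.indicator _) hy

/-- Finitely many terms stay bounded near the boundary, and the remaining ones carry an arbitrarily
small part of the norm. -/
theorem tendsto_sqrt_mul_LSeries (ha : Summable fun n => ‖a n‖ ^ 2) :
    Tendsto (fun x : ℝ => √x * LSeries a (x + 1 / 2)) (𝓝[>] 0) (𝓝 0) := by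
  refine Metric.tendsto_nhds.2 fun ε hε => ?_
  obtain ⟨S, hS⟩ := ((tendsto_tsum_compl_atTop_zero fun n => ‖a n‖ ^ 2).eventually
    (gt_mem_nhds (pow_pos hε 2))).exists
  set τ : ℝ := √(∑' n : {n // n ∉ S}, ‖a n‖ ^ 2)
  set head : ℝ → ℂ := fun x => ∑ n ∈ S, LSeries.term a (x + 1 / 2) n
  have hτ : τ < ε := (Real.sqrt_lt' hε).2 hS
  have hhead : Continuous head := continuous_finsetSum S fun n _ =>
    (continuous_iff_continuousAt.2 fun s => (LSeries.hasDerivAt_term a n s).continuousAt).comp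
      (by fun_prop : Continuous fun x : ℝ => (x : ℂ) + 1 / 2)
  have hlim : Tendsto (fun x : ℝ => √x * ‖head x‖ + τ * (√x + 1)) (𝓝[>] 0) (𝓝 τ) := by
    have hc : Continuous fun x : ℝ => √x * ‖head x‖ + τ * (√x + 1) := by fun_prop
    simpa using (hc.tendsto 0).mono_left nhdsWithin_le_nhds
  filter_upwards [hlim.eventually (gt_mem_nhds hτ), self_mem_nhdsWithin] with x hlt hx
  have hx0 : 0 < x := hx
  have htail := norm_LSeries_sub_sum_le ha S (y := x) (by simpa using hx0)
  have hmul : √x * x ^ (-(1 / 2) : ℝ) = 1 := by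
    rw [Real.sqrt_eq_rpow, ← Real.rpow_add hx0]
    norm_num
  rw [dist_zero_right, norm_mul, norm_real, Real.norm_of_nonneg (Real.sqrt_nonneg x)]
  calc √x * ‖LSeries a (x + 1 / 2)‖
      ≤ √x * (‖head x‖ + τ * (1 + x ^ (-(1 / 2) : ℝ))) := by
        gcongr
        exact (norm_le_norm_add_norm_sub' _ _).trans (add_le_add_right htail _)
    _ = √x * ‖head x‖ + τ * (√x + 1) := by linear_combination τ * hmul
    _ < ε := hlt

lemma abscissaOfAbsConv_le_half (ha : Summable fun n => ‖a n‖ ^ 2) :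
    LSeries.abscissaOfAbsConv a ≤ (1 / 2 : ℝ) :=
  LSeries.abscissaOfAbsConv_le_of_forall_lt_LSeriesSummable fun x hx => by
    have h := (summable_and_tsum_norm_term_le ha (y := (x - 1 / 2 : ℝ)) (by simpa using hx)).1
    have hadd : ((x - 1 / 2 : ℝ) : ℂ) + 1 / 2 = x := by
      push_cast
      ring
    exact hadd ▸ h.of_norm

lemma abscissaOfAbsConv_lt_add_half_re (ha : Summable fun n => ‖a n‖ ^ 2) {y : ℂ}
    (hy : 0 < y.re) : LSeries.abscissaOfAbsConv a < (y + 1 / 2).re := by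
  refine (abscissaOfAbsConv_le_half ha).trans_lt (EReal.coe_lt_coe ?_)
  rw [add_half_re]
  linarith

end DirichletSeries

section ZetaKernel

/-- The kernel of the operator `opH` in the variable `u = w + s - 1`, which puts the pole of the
zeta function at the origin. -/
noncomputable def zetaKernel (u : ℂ) : ℂ :=
  riemannZeta (1 + u) - 1

lemma LSeriesHasSum_delta (s : ℂ) : LSeriesHasSum LSeries.delta s 1 := by
  have hterm : LSeries.term LSeries.delta s = Pi.single 1 1 := by
    ext n
    rw [LSeries.term_delta, Pi.single_apply]
  rw [LSeriesHasSum, hterm]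
  exact hasSum_pi_single 1 1

lemma LSeriesHasSum_one_sub_delta {s : ℂ} (hs : 1 < s.re) :
    LSeriesHasSum (1 - LSeries.delta) s (riemannZeta s - 1) :=
  (LSeriesHasSum_one hs).sub (LSeriesHasSum_delta s)

theorem isPoleKernel_zetaKernel : IsPoleKernel zetaKernel where
  exists_entire := by
    refine ⟨fun u => riemannZeta₀ (1 + u) - 1, ?_, fun u hu => ?_⟩
    · exact (differentiable_riemannZeta₀.comp (by fun_prop)).sub_const 1
    · rw [zetaKernel, riemannZeta_eq_inv_sub_add (by simpa using hu), add_sub_cancel_left,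
        add_sub_assoc]
  exists_decay := by
    obtain ⟨B, hB⟩ := exists_norm_LSeries_le_exp (σ := 2) (by simp [LSeries.delta])
      (LSeriesHasSum_one_sub_delta (by norm_num)).LSeriesSummable
    refine ⟨B * Real.exp (-Real.log 2), Real.log 2, Real.log_pos one_lt_two, fun u hu => ?_⟩
    have hre : (1 + u).re = 1 + u.re := by simp
    have hle := hB (1 + u) (by linarith)
    rwa [(LSeriesHasSum_one_sub_delta (by linarith)).LSeries_eq, hre, mul_add, mul_one,
      Real.exp_add, ← mul_assoc] at hle

end ZetaKernel

section Symbol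

variable {b : ℕ → ℂ} {s : ℂ}

lemma term_add_ofReal (b : ℕ → ℂ) (s : ℂ) (y : ℝ) (n : ℕ) :
    LSeries.term b (s + y) n = LSeries.term b s n * exp (-Real.log n * y) := by
  rcases eq_or_ne n 0 with rfl | hn
  · simp
  · have hn0 : (n : ℂ) ≠ 0 := Nat.cast_ne_zero.2 hn
    have hexp : exp (-Real.log n * y) = ((n : ℂ) ^ (y : ℂ))⁻¹ := by
      rw [cpow_def_of_ne_zero hn0, ← exp_neg, natCast_log, neg_mul]
    rw [LSeries.term_of_ne_zero hn, LSeries.term_of_ne_zero hn, cpow_add _ _ hn0, hexp, ← div_div,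
      div_eq_mul_inv]

lemma norm_term_add_ofReal (b : ℕ → ℂ) (s : ℂ) (y : ℝ) (n : ℕ) :
    ‖LSeries.term b (s + y) n‖ = ‖LSeries.term b s n‖ * Real.exp (-Real.log n * y) := by
  rw [term_add_ofReal, norm_mul, ← ofReal_neg, ← ofReal_mul, norm_exp_ofReal]

lemma log_natCast_pos {n : ℕ} (hn : 2 ≤ n) : 0 < Real.log n :=
  Real.log_pos (Nat.one_lt_cast.2 hn)

lemma integrableOn_term (hb : b 1 = 0) (s : ℂ) (n : ℕ) :
    IntegrableOn (fun y : ℝ => LSeries.term b (s + y) n) (Ioi 0) := by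
  match n with
  | 0 => simp
  | 1 => simp [LSeries.term_of_ne_zero, hb]
  | n + 2 =>
    simp only [term_add_ofReal]
    exact (integrableOn_exp_mul_complex_Ioi
      (by simpa using log_natCast_pos (Nat.le_add_left 2 n)) 0).const_mul _

lemma integral_term (hb : b 1 = 0) (s : ℂ) (n : ℕ) :
    ∫ y in Ioi (0 : ℝ), LSeries.term b (s + y) n =
      LSeries.term (fun n => b n / Real.log n) s n := by
  match n with
  | 0 => simp
  | 1 => simp [LSeries.term_of_ne_zero, hb]
  | n + 2 =>
    simp only [term_add_ofReal]
    rw [integral_const_mul, integral_exp_mul_complex_Ioi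
      (by simpa using log_natCast_pos (Nat.le_add_left 2 n))]
    simp only [LSeries.term_of_ne_zero (Nat.succ_ne_zero _), ofReal_zero, mul_zero, exp_zero]
    ring

lemma integral_norm_term_le (hb : b 1 = 0) (s : ℂ) (n : ℕ) :
    ∫ y in Ioi (0 : ℝ), ‖LSeries.term b (s + y) n‖ ≤ ‖LSeries.term b s n‖ / Real.log 2 := by
  match n with
  | 0 => simp
  | 1 => simp [LSeries.term_of_ne_zero, hb]
  | n + 2 =>
    have hlog := log_natCast_pos (Nat.le_add_left 2 n)
    simp only [norm_term_add_ofReal]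
    rw [integral_const_mul, integral_exp_mul_Ioi (neg_neg_of_pos hlog), mul_zero, Real.exp_zero,
      neg_div_neg_eq, mul_one_div]
    gcongr
    exact_mod_cast Nat.le_add_left 2 n

theorem integral_LSeries (hb : b 1 = 0) (h : LSeriesSummable b s) :
    ∫ y in Ioi (0 : ℝ), LSeries b (s + y) = LSeries (fun n => b n / Real.log n) s := by
  have hsum : Summable fun n => ∫ y in Ioi (0 : ℝ), ‖LSeries.term b (s + y) n‖ :=
    .of_nonneg_of_le (fun n => integral_nonneg fun y => norm_nonneg _)
      (integral_norm_term_le hb s) (h.norm.div_const _)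
  simp only [LSeries, ← integral_term hb]
  exact (integral_tsum_of_summable_integral_norm (integrableOn_term hb s) hsum).symm

theorem symbol_add_half {x : ℝ} (hx : 0 < x) :
    symbol (x + 1 / 2) = ∫ y in Ioi (0 : ℝ), zetaKernel (x + y) := by
  have hkernel {y : ℝ} (hy : 0 ≤ y) :
      LSeriesHasSum (1 - LSeries.delta) (1 + x + y) (zetaKernel (x + y)) := by
    rw [zetaKernel, ← add_assoc]
    refine LSeriesHasSum_one_sub_delta ?_
    simp only [add_re, one_re, ofReal_re]
    linarith
  have hsummable := (hkernel le_rfl).LSeriesSummable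
  rw [ofReal_zero, add_zero] at hsummable
  rw [setIntegral_congr_fun measurableSet_Ioi fun y hy => (hkernel (le_of_lt hy)).LSeries_eq.symm,
    integral_LSeries (by simp [LSeries.delta]) hsummable, symbol, LSeries, LSeries]
  refine tsum_congr fun n => ?_
  match n with
  | 0 => simp
  | 1 => simp [LSeries.term_of_ne_zero]
  | n + 2 =>
    have hn : ((n + 2 : ℕ) : ℂ) ≠ 0 := Nat.cast_ne_zero.2 (by simp)
    have hsqrt : ((√(n + 2 : ℕ) : ℝ) : ℂ) = ((n + 2 : ℕ) : ℂ) ^ (1 / 2 : ℂ) := by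
      rw [Real.sqrt_eq_rpow, ofReal_cpow (by positivity)]
      norm_num
    have hpow : ((n + 2 : ℕ) : ℂ) ^ (1 + x : ℂ) =
        ((n + 2 : ℕ) : ℂ) ^ (1 / 2 : ℂ) * ((n + 2 : ℕ) : ℂ) ^ (x + 1 / 2 : ℂ) := by
      rw [← cpow_add _ _ hn]
      ring_nf
    rw [LSeries.term_of_ne_zero (by simp), LSeries.term_of_ne_zero (by simp), hpow, ← hsqrt]
    simp only [LSeries.delta, Pi.sub_apply, Pi.one_apply, Nat.reduceEqDiff, ↓reduceIte, sub_zero,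
      le_add_iff_nonneg_left, zero_le, one_div, mul_inv_rev, ofReal_mul, ofReal_inv]
    ring

end Symbol

section Solution

lemma opH_add_half (f : ℂ → ℂ) (x : ℂ) :
    opH f (x + 1 / 2) = ∫ y in Ioi (0 : ℝ), f (y + 1 / 2) * zetaKernel (x + y) := by
  have hshift := (measurePreserving_add_right volume (1 / 2 : ℝ)).setIntegral_preimage_emb
    (measurableEmbedding_addRight (1 / 2 : ℝ))
    (fun w : ℝ => f w * (riemannZeta (w + (x + 1 / 2)) - 1)) (Ioi (1 / 2))
  rw [preimage_add_const_Ioi, sub_self] at hshift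
  rw [opH, ← hshift]
  refine setIntegral_congr_fun measurableSet_Ioi fun y _ => ?_
  simp only [zetaKernel]
  push_cast
  ring_nf

variable {a : ℕ → ℂ}

lemma isHardyLike_LSeries (ha : Summable fun n => ‖a n‖ ^ 2) (c : ℂ) :
    IsHardyLike fun y => LSeries a (y + 1 / 2) - c where
  differentiableAt y hy := by
    have hlt := abscissaOfAbsConv_lt_add_half_re ha hy
    exact ((LSeries_hasDerivAt hlt).differentiableAt.comp (f := fun y => y + 1 / 2) y
      (by fun_prop)).sub_const c
  exists_norm_le := by
    refine ⟨√(∑' n, ‖a n‖ ^ 2) + ‖c‖, fun y hy => ?_⟩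
    have hrpow : 0 ≤ y.re ^ (-(1 / 2) : ℝ) := by positivity
    calc ‖LSeries a (y + 1 / 2) - c‖ ≤ ‖LSeries a (y + 1 / 2)‖ + ‖c‖ := norm_sub_le _ _
      _ ≤ √(∑' n, ‖a n‖ ^ 2) * (1 + y.re ^ (-(1 / 2) : ℝ)) +
          ‖c‖ * (1 + y.re ^ (-(1 / 2) : ℝ)) := by
        gcongr
        · exact norm_LSeries_add_half_le ha hy
        · exact le_mul_of_one_le_right (norm_nonneg c) (by linarith)
      _ = (√(∑' n, ‖a n‖ ^ 2) + ‖c‖) * (1 + y.re ^ (-(1 / 2) : ℝ)) := by ring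

lemma IsHardyLike.integrableOn_mul {K G : ℂ → ℂ} (hG : IsHardyLike G) (hK : IsPoleKernel K) {x : ℝ}
    (hx : 0 < x) : IntegrableOn (fun y : ℝ => G y * K (x + y)) (Ioi 0) := by
  have h := hG.rayIntegrable_mul hK (α := 0) (v := Real.log x) (by simp [Real.pi_pos])
    (by simp [Real.pi_pos])
  simpa [RayIntegrable, ← ofReal_exp, Real.exp_log hx] using h

theorem isSolution_LSeries (ha : Summable fun n => ‖a n‖ ^ 2) {lam c : ℂ}
    (heq : ∀ s : ℝ, 1 / 2 < s → opH (LSeries a) s - lam * LSeries a s = c * symbol s) :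
    IsSolution zetaKernel (fun y => LSeries a (y + 1 / 2) - c) lam c where
  toIsHardyLike := isHardyLike_LSeries ha c
  eqn x hx := by
    have hK := isPoleKernel_zetaKernel
    have hf : IntegrableOn (fun y : ℝ => LSeries a (y + 1 / 2) * zetaKernel (x + y)) (Ioi 0) := by
      simpa using (isHardyLike_LSeries ha 0).integrableOn_mul hK hx
    have hc : IntegrableOn (fun y : ℝ => c * zetaKernel (x + y)) (Ioi 0) := by
      simpa using (isHardyLike_LSeries (a := 0) (by simp) (-c)).integrableOn_mul hK hx
    have hx' := heq (x + 1 / 2) (by linarith)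
    have hhalf : ((1 / 2 : ℝ) : ℂ) = 1 / 2 := by norm_num
    rw [ofReal_add, hhalf, opH_add_half, symbol_add_half hx] at hx'
    simp only [sub_mul, sub_add_cancel]
    rw [integral_sub hf hc, integral_const_mul, ← hx']
    ring

end Solution

section Series

variable {J J₁ J₂ : ℂ → ℂ}

lemma exists_bounded_hasSum_pow (hJ : Differentiable ℂ J) :
    ∃ j : ℕ → ℂ, (∃ C, ∀ n, ‖j n‖ ≤ C) ∧ ∀ w, HasSum (fun n => j n * w ^ n) (J w) := by
  have hsum (w : ℂ) :
      HasSum (fun n : ℕ => ((n.factorial : ℂ)⁻¹ * iteratedDeriv n J 0) * w ^ n) (J w) := by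
    refine (hasSum_taylorSeries_of_entire hJ 0 w).congr_fun fun n => ?_
    simp only [smul_eq_mul, sub_zero]
    ring
  refine ⟨_, ?_, hsum⟩
  have hzero := (hsum 1).summable.tendsto_atTop_zero
  simp only [one_pow, mul_one] at hzero
  obtain ⟨C, hC⟩ := hzero.norm.bddAbove_range
  exact ⟨C, fun n => hC ⟨n, rfl⟩⟩

lemma polyBounded_of_bounded {j : ℕ → ℂ} {C : ℝ} (h : ∀ n, ‖j n‖ ≤ C) :
    PolyBounded fun k : ℕ+ => j k.natPred :=
  ⟨C, 0, fun k => by simpa using h k.natPred⟩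

lemma hasSum_repTerm {j₁ j₂ : ℕ → ℂ} (h₁ : ∀ w, HasSum (fun n => j₁ n * w ^ n) (J₁ w))
    (h₂ : ∀ w, HasSum (fun n => j₂ n * w ^ n) (J₂ w)) (θ : ℝ) {x : ℝ} (hx : 0 < x) :
    HasSum (repTerm θ x (fun k => j₁ k.natPred) fun k => j₂ k.natPred)
      ((x : ℂ) ^ (3 / 2 - I * θ) * J₁ (x ^ 2) + (x : ℂ) ^ (3 / 2 + I * θ) * J₂ (x ^ 2)) := by
  rw [← Equiv.pnatEquivNat.symm.hasSum_iff]
  refine (((h₁ (x ^ 2)).mul_left _).add ((h₂ (x ^ 2)).mul_left _)).congr_fun fun n => ?_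
  have hx0 : (x : ℂ) ≠ 0 := ofReal_ne_zero.2 hx.ne'
  have hpow : ((x ^ (2 * ((n.succPNat : ℕ+) : ℝ) - 1 / 2) : ℝ) : ℂ) =
      (x : ℂ) ^ (3 / 2 : ℂ) * (x ^ 2) ^ n := by
    rw [ofReal_cpow hx.le, ← pow_mul, ← cpow_natCast, ← cpow_add _ _ hx0]
    congr 1
    rw [Nat.succPNat_coe]
    push_cast
    ring
  simp only [Function.comp_apply, Equiv.pnatEquivNat_symm_apply, repTerm, Nat.natPred_succPNat]
  rw [hpow, sub_eq_add_neg, cpow_add _ _ hx0, cpow_add _ _ hx0]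
  ring

theorem exists_polyBounded_hasSum_repTerm (hJ₁ : Differentiable ℂ J₁) (hJ₂ : Differentiable ℂ J₂)
    (θ : ℝ) :
    ∃ ck dk : ℕ+ → ℂ, PolyBounded ck ∧ PolyBounded dk ∧ ∀ x : ℝ, 0 < x →
      HasSum (repTerm θ x ck dk)
        ((x : ℂ) ^ (3 / 2 - I * θ) * J₁ (x ^ 2) + (x : ℂ) ^ (3 / 2 + I * θ) * J₂ (x ^ 2)) := by
  obtain ⟨j₁, ⟨C₁, hC₁⟩, h₁⟩ := exists_bounded_hasSum_pow hJ₁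
  obtain ⟨j₂, ⟨C₂, hC₂⟩, h₂⟩ := exists_bounded_hasSum_pow hJ₂
  exact ⟨_, _, polyBounded_of_bounded hC₁, polyBounded_of_bounded hC₂,
    fun x hx => hasSum_repTerm h₁ h₂ θ hx⟩

end Series

section Derivative

lemma exists_continuous_hasDerivAt_cpow_mul {J : ℂ → ℂ} (hJ : Differentiable ℂ J) {b : ℂ}
    (hb : 1 < b.re) :
    ∃ D : ℝ → ℂ, Continuous D ∧
      ∀ x : ℝ, 0 < x → HasDerivAt (fun x : ℝ => (x : ℂ) ^ b * J (x ^ 2)) (D x) x := by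
  have hJ' : Continuous (deriv J) := (hJ.contDiff (n := 1)).continuous_deriv le_rfl
  have hpow := continuous_ofReal_cpow_const (y := b) (by linarith)
  have hpow' := continuous_ofReal_cpow_const (y := b - 1) (by simpa using hb)
  have hJc := hJ.continuous
  refine ⟨fun x => b * (x : ℂ) ^ (b - 1) * J (x ^ 2) +
    (x : ℂ) ^ b * (deriv J (x ^ 2) * (2 * x)), by fun_prop, fun x hx => ?_⟩
  have hsq : HasDerivAt (fun x : ℝ => (x : ℂ) ^ 2) (2 * x) x := by
    simpa using (hasDerivAt_pow 2 (x : ℂ)).comp_ofReal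
  have hcpow : HasDerivAt (fun x : ℝ => (x : ℂ) ^ b) (b * (x : ℂ) ^ (b - 1)) x :=
    hasDerivAt_ofReal_cpow_const hx.ne' fun h => by norm_num [h] at hb
  exact hcpow.mul ((hJ _).hasDerivAt.comp x hsq)

lemma memLp_two_of_isBigO_exp_neg {D : ℝ → ℂ} {x₀ δ : ℝ} (hδ : 0 < δ)
    (hD : ContinuousOn D (Ici x₀)) (hO : D =O[atTop] fun x => Real.exp (-δ * x)) :
    MemLp D 2 (volume.restrict (Ioi x₀)) := by
  have hmeas : AEStronglyMeasurable D (volume.restrict (Ioi x₀)) :=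
    (hD.mono Ioi_subset_Ici_self).aestronglyMeasurable measurableSet_Ioi
  rw [memLp_two_iff_integrable_sq_norm hmeas]
  refine integrable_of_isBigO_exp_neg (b := 2 * δ) (by positivity) (hD.norm.pow 2) ?_
  refine (hO.norm_left.pow 2).congr_right fun x => ?_
  rw [← Real.exp_nat_mul]
  push_cast
  ring_nf

variable {a : ℕ → ℂ}

lemma isBigO_deriv_LSeries {σ : ℝ} (hσ : LSeries.abscissaOfAbsConv a < σ) :
    (fun s : ℝ => deriv (LSeries a) s) =O[atTop] fun s => Real.exp (-Real.log 2 * s) := by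
  obtain ⟨B, hB⟩ := exists_norm_LSeries_le_exp (a := LSeries.logMul a) (σ := σ)
    (by simp [LSeries.logMul]) (LSeriesSummable_logMul_of_lt_re (by simpa using hσ))
  refine IsBigO.of_bound B ?_
  filter_upwards [eventually_ge_atTop σ] with s hs
  rw [LSeries_deriv (hσ.trans_le (by simpa using hs)), norm_neg,
    Real.norm_of_nonneg (Real.exp_nonneg _)]
  simpa using hB s (by simpa using hs)

lemma hasDerivAt_LSeries_add_half (ha : Summable fun n => ‖a n‖ ^ 2) {x : ℝ} (hx : 0 < x) :
    HasDerivAt (fun x : ℝ => LSeries a (x + 1 / 2)) (deriv (LSeries a) (x + 1 / 2)) x := by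
  have hlt := abscissaOfAbsConv_lt_add_half_re ha (y := x) (by simpa using hx)
  exact ((LSeries_hasDerivAt hlt).differentiableAt.hasDerivAt.comp_add_const (x : ℂ)
    (1 / 2)).comp_ofReal

theorem memLp_deriv_LSeries (ha : Summable fun n => ‖a n‖ ^ 2) {D : ℝ → ℂ} (hD : Continuous D)
    (hderiv : ∀ x : ℝ, 0 < x → deriv (LSeries a) (x + 1 / 2) = D x) :
    MemLp (fun s : ℝ => deriv (LSeries a) s) 2 (volume.restrict (Ioi (1 / 2))) := by
  have heq {s : ℝ} (hs : 1 / 2 < s) : D (s - 1 / 2) = deriv (LSeries a) s := by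
    rw [← hderiv _ (sub_pos.2 hs)]
    push_cast
    rw [sub_add_cancel]
  have hO : (fun s : ℝ => D (s - 1 / 2)) =O[atTop] fun s => Real.exp (-Real.log 2 * s) := by
    refine (isBigO_deriv_LSeries (a := a) (σ := 1) ?_).congr' ?_ .rfl
    · exact (abscissaOfAbsConv_le_half ha).trans_lt (EReal.coe_lt_coe one_half_lt_one)
    · filter_upwards [eventually_gt_atTop (1 / 2)] with s hs using (heq hs).symm
  refine (memLp_congr_ae ?_).1
    (memLp_two_of_isBigO_exp_neg (Real.log_pos one_lt_two) (by fun_prop) hO)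
  filter_upwards [ae_restrict_mem measurableSet_Ioi] with s hs using heq hs

theorem memLp_deriv_LSeries_of_cpow (ha : Summable fun n => ‖a n‖ ^ 2) {c b₁ b₂ : ℂ}
    {J₁ J₂ : ℂ → ℂ} (hb₁ : 1 < b₁.re) (hb₂ : 1 < b₂.re) (hJ₁ : Differentiable ℂ J₁)
    (hJ₂ : Differentiable ℂ J₂)
    (h : ∀ x : ℝ, 0 < x →
      LSeries a (x + 1 / 2) - c = (x : ℂ) ^ b₁ * J₁ (x ^ 2) + (x : ℂ) ^ b₂ * J₂ (x ^ 2)) :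
    MemLp (fun s : ℝ => deriv (LSeries a) s) 2 (volume.restrict (Ioi (1 / 2))) := by
  obtain ⟨D₁, hD₁, hd₁⟩ := exists_continuous_hasDerivAt_cpow_mul hJ₁ hb₁
  obtain ⟨D₂, hD₂, hd₂⟩ := exists_continuous_hasDerivAt_cpow_mul hJ₂ hb₂
  refine memLp_deriv_LSeries ha (hD₁.add hD₂) fun x hx => ?_
  refine ((hasDerivAt_LSeries_add_half ha hx).sub_const c).unique ?_
  refine ((hd₁ x hx).add (hd₂ x hx)).congr_of_eventuallyEq ?_
  filter_upwards [eventually_gt_nhds hx] with y hy using h y hy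

end Derivative

lemma MemH20.exists_eqOn_LSeries {f : ℂ → ℂ} (hf : MemH20 f) :
    ∃ a : ℕ → ℂ, (Summable fun n => ‖a n‖ ^ 2) ∧ EqOn f (LSeries a) halfPlane := by
  obtain ⟨a, -, -, ha, hsum⟩ := hf
  exact ⟨a, ha, fun s hs => (hsum s hs).LSeries_eq.symm⟩

lemma isOpen_halfPlane : IsOpen halfPlane :=
  isOpen_lt continuous_const continuous_re

lemma ofReal_mem_halfPlane {s : ℝ} (hs : 1 / 2 < s) : (s : ℂ) ∈ halfPlane := by
  simpa [halfPlane] using hs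

lemma differentiableOn_LSeries {a : ℕ → ℂ} (ha : Summable fun n => ‖a n‖ ^ 2) :
    DifferentiableOn ℂ (LSeries a) halfPlane :=
  (LSeries_differentiableOn a).mono fun _ hs =>
    (abscissaOfAbsConv_le_half ha).trans_lt (EReal.coe_lt_coe hs)

lemma opH_congr {f g : ℂ → ℂ} (h : EqOn f g halfPlane) : opH f = opH g :=
  funext fun s => setIntegral_congr_fun measurableSet_Ioi fun w hw => by
    simp only [h (ofReal_mem_halfPlane hw)]

lemma tendsto_sqrt_mul_LSeries_sub {a : ℕ → ℂ} (ha : Summable fun n => ‖a n‖ ^ 2) (c : ℂ) :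
    Tendsto (fun x : ℝ => √x * (LSeries a (x + 1 / 2) - c)) (𝓝[>] 0) (𝓝 0) := by
  have hc : Tendsto (fun x : ℝ => √x * c) (𝓝[>] 0) (𝓝 0) := by
    have hcont : Continuous fun x : ℝ => √x * c := by fun_prop
    simpa using (hcont.tendsto 0).mono_left nhdsWithin_le_nhds
  simpa only [mul_sub, sub_zero] using (tendsto_sqrt_mul_LSeries ha).sub hc

end MultHilbert

open MultHilbert in
theorem theorem3_general {lam : ℝ} (hlam0 : 0 < lam) (hlampi : lam < π) {c : ℂ} {f : ℂ → ℂ}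
    (hf : MemH20 f)
    (heq : ∀ s : ℝ, 1 / 2 < s → opH f s - lam * f s = c * symbol s) :
    (∃ ck dk : ℕ+ → ℂ, PolyBounded ck ∧ PolyBounded dk ∧
      ∀ s : ℝ, 1 / 2 < s → HasSum (repTerm (theta lam) (s - 1 / 2) ck dk) (f s - c)) ∧
    DifferentiableOn ℂ f halfPlane ∧
    MemLp (fun s : ℝ => deriv f s) 2 (volume.restrict (Ioi (1 / 2))) := by
  obtain ⟨a, ha, hfa⟩ := hf.exists_eqOn_LSeries
  have hsol : IsSolution zetaKernel (fun y => LSeries a (y + 1 / 2) - c) lam c :=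
    isSolution_LSeries ha fun s hs => by
      rw [← opH_congr hfa, ← hfa (ofReal_mem_halfPlane hs), heq s hs]
  obtain ⟨J₁, J₂, hJ₁, hJ₂, hJ⟩ := hsol.exists_decomposition isPoleKernel_zetaKernel hlam0 hlampi
    (tendsto_sqrt_mul_LSeries_sub ha c)
  obtain ⟨ck, dk, hck, hdk, hsum⟩ := exists_polyBounded_hasSum_repTerm hJ₁ hJ₂ (theta lam)
  refine ⟨⟨ck, dk, hck, hdk, fun s hs => ?_⟩, (differentiableOn_LSeries ha).congr hfa,
    (memLp_congr_ae ?_).1 (memLp_deriv_LSeries_of_cpow ha (by norm_num) (by norm_num) hJ₁ hJ₂ hJ)⟩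
  · have hx := hsum (s - 1 / 2) (sub_pos.2 hs)
    rw [← hJ _ (sub_pos.2 hs)] at hx
    push_cast at hx
    rwa [sub_add_cancel, ← hfa (ofReal_mem_halfPlane hs)] at hx
  · filter_upwards [ae_restrict_mem measurableSet_Ioi] with s hs
    have hmem : halfPlane ∈ 𝓝 (s : ℂ) := isOpen_halfPlane.mem_nhds (ofReal_mem_halfPlane hs)
    exact (hfa.eventuallyEq_of_mem hmem).deriv_eq.symm

theorem theorem3 (lam : ℝ) (hlam0 : 0 < lam) (hlampi : lam < Real.pi) (c : ℂ) (f : ℂ → ℂ)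
    (hf : MultHilbert.MemH20 f)
    (heq : ∀ s ∈ MultHilbert.halfPlane,
      MultHilbert.opH f s - (lam : ℂ) * f s = c * MultHilbert.symbol s) :
    (∃ (d : ℂ) (ck dk : ℕ+ → ℂ),
      MultHilbert.PolyBounded ck ∧ MultHilbert.PolyBounded dk ∧
      ∀ s : ℝ, 1 / 2 < s → s < 3 / 2 →
        Summable (MultHilbert.repTerm (MultHilbert.theta lam) (s - 1 / 2) ck dk) ∧
        f (s : ℂ) = c * d +
          ∑' k : ℕ+, MultHilbert.repTerm (MultHilbert.theta lam) (s - 1 / 2) ck dk k) ∧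
    DifferentiableOn ℂ f MultHilbert.halfPlane ∧
    MemLp (fun s : ℝ => deriv f (s : ℂ)) 2 (volume.restrict (Ioi (1 / 2 : ℝ))) := by
  obtain ⟨⟨ck, dk, hck, hdk, hsum⟩, hdiff, hderiv⟩ := theorem3_general hlam0 hlampi hf fun s hs =>
    heq s (MultHilbert.ofReal_mem_halfPlane hs)
  exact ⟨⟨1, ck, dk, hck, hdk, fun s hs _ => ⟨(hsum s hs).summable, by
    rw [(hsum s hs).tsum_eq, mul_one, add_sub_cancel]⟩⟩, hdiff, hderiv⟩
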